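/- Let $F$ be a distribution function on $\mathbb{R}$ with $F(0)=0$, put $\bar F=1-F$, and let $x^*=\sup\{x: F(x)<1\}\in(0,\infty]$ be its right endpoint. Let $d\ge 2$ be an integer and let $$\psi(x)=\mathfrak{W}_dF(x)=\int_{(x,\infty)}\Bigl(1-\frac{x}{t}\Bigr)^{d-1}dF(t),\qquad x\ge 0,$$ be the Williamson $d$-transform of $F$. On $(0,\infty)$, $\psi$ is $d-2$ times differentiable and $(-1)^{d-2}\psi^{(d-2)}$ is convex; $\psi^{(d-1)}$ denotes the right-continuous version of the density of $\psi^{(d-2)}$, i.e. its right derivative. The function $\psi$ is regarded as the survival function of a distribution on $[0,\infty)$ (so $\psi(x)=1$ for $x<0$). A distribution function $G$ is in $\mathrm{MDA}(\Lambda)$, the maximum domain of attraction of the Gumbel law $\Lambda(x)=\exp(-e^{-x})$, if there are $c_n>0$ and $b_n\in\mathbb{R}$ with $G(c_nx+b_n)^n\to\Lambda(x)$ for all $x\in\mathbb{R}$; $\psi\in\mathrm{MDA}(\Lambda)$ means $1-\psi\in\mathrm{MDA}(\Lambda)$. If $\bar G$ is the survival function of $G$ and $e$ is the right endpoint of $G$,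 then a function $a$ that is positive on $(-\infty,e)$ is called an auxiliary function of $\bar G$ if $a(x)/x\to 0$ as $x\uparrow e$ and $$\lim_{x\uparrow e}\frac{\bar G(x+a(x)t)}{\bar G(x)}=e^{-t}\qquad\text{for all }t\in\mathbb{R}.$$ Suppose that $F$ or $\psi^{(d-1)}$ is differentiable on $(0,\infty)$. Then both are differentiable on $(0,\infty)$. If, in addition, $F'$ is monotone (non-decreasing or non-increasing) on $(x_0,x^*)$ for some $x_0<x^*$, then $$F\in\mathrm{MDA}(\Lambda)\iff\psi\in\mathrm{MDA}(\Lambda),$$ and in this case each of the two functions $$a(x)=\frac{\int_x^{x^*}\bar F(t)\,dt}{\bar F(x)}\qquad\text{and}\qquad a(x)=\frac{\int_x^{x^*}\psi(t)\,dt}{\psi(x)}$$ is an auxiliary function of both $\bar F$ and $\psi$. -/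

import Mathlib

open Set Filter Topology MeasureTheory

noncomputable section

/-- The Williamson `d`-transform of the distribution function `F`,
`x ↦ ∫_{(x, ∞)} (1 - x / t) ^ (d - 1) dF(t)`, meant for `x ≥ 0`. At `x = 0` it is `1 - F 0`. -/
def williamson (d : ℕ) (F : StieltjesFunction ℝ) (x : ℝ) : ℝ :=
  ∫ t in Ioi x, (1 - x / t) ^ (d - 1) ∂F.measure

/-- The function `ψ^(d-1)` on `(0, ∞)` for `ψ` the Williamson `d`-transform of `F`. In general
`ψ^(d-2)` is only (up to sign) convex on `(0, ∞)`, and `ψ^(d-1)` denotes the right-continuous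
version of its density; for a convex function this is its right derivative. -/
def williamsonTopDeriv (d : ℕ) (F : StieltjesFunction ℝ) (x : ℝ) : ℝ :=
  derivWithin (iteratedDeriv (d - 2) (williamson d F)) (Ioi x) x

/-- The distribution function on `ℝ` of the law on `[0, ∞)` whose survival function is the
Williamson `d`-transform of `F`. -/
def williamsonDF (d : ℕ) (F : StieltjesFunction ℝ) (x : ℝ) : ℝ :=
  if x < 0 then 0 else 1 - williamson d F x

/-- `F` is in the maximum domain of attraction of `G`: for some `c n > 0` and `b n`, the functions
`x ↦ F (c n * x + b n) ^ n` converge weakly to `G`, that is, at each continuity point of `G`. -/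
def InMDA (F G : ℝ → ℝ) : Prop :=
  ∃ c b : ℕ → ℝ, (∀ n, 0 < c n) ∧
    ∀ x, ContinuousAt G x → Tendsto (fun n : ℕ => F (c n * x + b n) ^ n) atTop (𝓝 (G x))

/-- The Gumbel distribution function. -/
def gumbel (x : ℝ) : ℝ := Real.exp (-Real.exp (-x))

/-- The right endpoint `sup {x | F x < 1}` of a distribution function, possibly infinite. -/
def rightEndpoint (F : ℝ → ℝ) : EReal := sSup ((fun x : ℝ => (x : EReal)) '' {x : ℝ | F x < 1})

/-- The filter on `ℝ` for limits `x ↑ e`, where `e` may be infinite. -/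
def upTo (e : EReal) : Filter ℝ := comap (fun x : ℝ => (x : EReal)) (𝓝[<] e)

/-- `a` is an auxiliary function (in the sense of the Gumbel domain) of the distribution function
`F`, or equivalently of its survival function `1 - F`. -/
def IsAuxiliaryFunction (F a : ℝ → ℝ) : Prop :=
  (∀ x : ℝ, (x : EReal) < rightEndpoint F → 0 < a x) ∧
  Tendsto (fun x => a x / x) (upTo (rightEndpoint F)) (𝓝 0) ∧
  ∀ t : ℝ, Tendsto (fun x => (1 - F (x + a x * t)) / (1 - F x)) (upTo (rightEndpoint F))
    (𝓝 (Real.exp (-t)))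

/-- The function `x ↦ (∫_x^e (1 - G t) dt) / (1 - G x)`. If the integral diverges, Lean's value
is `0`, so that positivity of this function for `x < e` contains the convergence of the integral. -/
def meanExcess (e : EReal) (G : ℝ → ℝ) (x : ℝ) : ℝ :=
  (∫ t in {t : ℝ | x < t ∧ (t : EReal) < e}, (1 - G t)) / (1 - G x)

/-- `f` is monotone (non-decreasing or non-increasing) on `(x₀, e)` for some `x₀ < e`. -/
def MonotoneNearLeft (f : ℝ → ℝ) (e : EReal) : Prop :=
  ∃ x₀ : ℝ, (x₀ : EReal) < e ∧
    (MonotoneOn f {x : ℝ | x₀ < x ∧ (x : EReal) < e} ∨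
      AntitoneOn f {x : ℝ | x₀ < x ∧ (x : EReal) < e})

end

/-! Membership in the Gumbel domain is restated as `Γ`-variation: `g (x + a x * t) / g x → e^{-t}`
as `x ↑ e` for some positive `a`. For a continuous survival function the two are equivalent
(`gammaVarying_of_inMDA`, `inMDA_of_gammaVarying`), and then `a` is self-neglecting and `a x / x →
0`. It remains to carry `Γ`-variation, with the same `a`, between the tail of `F` and `ψ`. Write `n
= d - 1`.

From `F` to `ψ`: integration by parts writes `ψ` as an integral against `1 - F`. Substituting `s = x
+ a x * u` and using dominated convergence, justified by a Potter type bound, gives `ψ x ~ n! (1 - F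
x) (a x / x) ^ n`. The factor `a x / x` does not vary on the scale `a`.

From `ψ` to `F`: let `M_j x = ∫_{(x,∞)} t⁻ⁿ (t - x) ^ j dF(t)`. Then `ψ = M_n`, and `(j + 1) M_j` is
a non-increasing density of `-M_{j+1}`. A monotone density theorem therefore passes `Γ`-variation
down to `M_0` and gives `M_{j+1} ~ (j + 1) a M_j`. The tail `1 - F` is a binomial combination of the
`x ^ (n - j) M_j`, in which `x ^ n M_0` dominates because `a x / x → 0`.

Both mean excess functions are equivalent to `a`, and equivalent auxiliary functions are
interchangeable. Differentiability transfers because `ψ^(n) = (-1)ⁿ n! M_0`, while the increments of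
`M_0` are those of `-F` weighted by `t⁻ⁿ`. -/

/-! ### Continuous survival functions and `Γ`-variation. -/

/-- A continuous survival function `g` of a law on `[0, ∞)` with right endpoint `e`. -/
structure IsContSurvival (g : ℝ → ℝ) (e : EReal) : Prop where
  cont : Continuous g
  anti : Antitone g
  eq_one : ∀ x ≤ 0, g x = 1
  nonneg : ∀ x, 0 ≤ g x
  tendsto_zero : Tendsto g atTop (𝓝 0)
  pos_iff : ∀ x : ℝ, (x : EReal) < e ↔ 0 < g x

/-- `g` is `Γ`-varying along `l` with auxiliary function `a`. -/
def GammaVarying (g a : ℝ → ℝ) (l : Filter ℝ) : Prop :=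
  ∀ t : ℝ, Tendsto (fun x => g (x + a x * t) / g x) l (𝓝 (Real.exp (-t)))

namespace IsContSurvival

variable {g : ℝ → ℝ} {e : EReal}

theorem le_one (hg : IsContSurvival g e) (x : ℝ) : g x ≤ 1 := by
  rcases le_total x 0 with h | h
  · exact (hg.eq_one x h).le
  · exact (hg.anti h).trans_eq (hg.eq_one 0 le_rfl)

theorem exists_eq (hg : IsContSurvival g e) {p : ℝ} (hp0 : 0 < p) (hp1 : p ≤ 1) :
    ∃ y, g y = p := by
  obtain ⟨z, hz⟩ := (hg.tendsto_zero.eventually (gt_mem_nhds hp0)).exists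
  exact mem_range_of_exists_le_of_exists_ge hg.cont ⟨z, hz.le⟩
    ⟨0, by rw [hg.eq_one 0 le_rfl]; exact hp1⟩

/-- Treats finite and infinite endpoints alike: approaching `e` means that `g` decreases to `0`
through positive values. Countable generation, needed for dominated convergence, follows. -/
theorem upTo_eq (hg : IsContSurvival g e) : upTo e = comap g (𝓝[>] 0) := by
  apply le_antisymm
  · rw [← tendsto_iff_comap]
    have hlt : ∀ᶠ x : ℝ in upTo e, (x : EReal) < e :=
      tendsto_comap.eventually self_mem_nhdsWithin
    refine tendsto_nhdsWithin_iff.2 ⟨?_, hlt.mono fun x hx => (hg.pos_iff x).1 hx⟩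
    refine tendsto_order.2 ⟨fun b hb => Eventually.of_forall fun x => hb.trans_le (hg.nonneg x),
      fun b hb => ?_⟩
    obtain ⟨y, hy⟩ := hg.exists_eq (p := min (b / 2) 1) (by positivity) (min_le_right _ _)
    have hye : (y : EReal) < e := (hg.pos_iff y).2 (by rw [hy]; positivity)
    have h2 : ∀ᶠ x : ℝ in upTo e, (y : EReal) < x :=
      tendsto_comap.eventually (mem_nhdsWithin_of_mem_nhds (lt_mem_nhds hye))
    filter_upwards [h2] with x hx
    have := hg.anti (EReal.coe_lt_coe_iff.1 hx).le
    have := min_le_left (b / 2) 1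
    linarith
  · unfold upTo
    rw [← tendsto_iff_comap]
    have hpos : ∀ᶠ x in comap g (𝓝[>] 0), 0 < g x :=
      tendsto_comap.eventually self_mem_nhdsWithin
    refine tendsto_nhdsWithin_iff.2 ⟨?_, hpos.mono fun x hx => (hg.pos_iff x).2 hx⟩
    refine tendsto_order.2 ⟨fun b hb => ?_, fun b hb => ?_⟩
    · obtain ⟨y, hy1, hy2⟩ := EReal.lt_iff_exists_real_btwn.1 hb
      have h2 : ∀ᶠ x in comap g (𝓝[>] 0), g x < g y :=
        tendsto_comap.eventually
          (mem_nhdsWithin_of_mem_nhds (gt_mem_nhds ((hg.pos_iff y).1 hy2)))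
      filter_upwards [h2] with x hx
      exact hy1.trans (EReal.coe_lt_coe_iff.2 (hg.anti.reflect_lt hx))
    · filter_upwards [hpos] with x hx
      exact ((hg.pos_iff x).2 hx).trans hb

theorem tendsto_upTo (hg : IsContSurvival g e) : Tendsto g (upTo e) (𝓝[>] 0) :=
  hg.upTo_eq ▸ tendsto_comap

theorem isCountablyGenerated (hg : IsContSurvival g e) : (upTo e).IsCountablyGenerated := by
  rw [hg.upTo_eq]; infer_instance

theorem eventually_pos (hg : IsContSurvival g e) : ∀ᶠ x in upTo e, 0 < g x :=
  hg.tendsto_upTo.eventually self_mem_nhdsWithin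

theorem pos_of_lt_one (hg : IsContSurvival g e) {x : ℝ} (h : g x < 1) : 0 < x := by
  by_contra hx
  exact h.ne (hg.eq_one x (not_lt.1 hx))

theorem eventually_arg_pos (hg : IsContSurvival g e) : ∀ᶠ x in upTo e, 0 < x := by
  filter_upwards [hg.tendsto_upTo.eventually (mem_nhdsWithin_of_mem_nhds
    (gt_mem_nhds (zero_lt_one' ℝ)))] with x hx
  exact hg.pos_of_lt_one hx

theorem eventually_lt_of_tendsto (hg : IsContSurvival g e) {u v : ℝ → ℝ} {α β : ℝ}
    (hu : Tendsto (fun x => g (u x) / g x) (upTo e) (𝓝 α))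
    (hv : Tendsto (fun x => g (v x) / g x) (upTo e) (𝓝 β)) (h : α < β) :
    ∀ᶠ x in upTo e, v x < u x := by
  filter_upwards [hu.eventually_lt hv h, hg.eventually_pos] with x hx hpos
  exact hg.anti.reflect_lt ((div_lt_div_iff_of_pos_right hpos).1 hx)

/-- A map that keeps the survival function comparable moves points towards the endpoint. -/
theorem tendsto_upTo_of_ratio (hg : IsContSurvival g e) {u : ℝ → ℝ} {α : ℝ} (hα : 0 < α)
    (hu : Tendsto (fun x => g (u x) / g x) (upTo e) (𝓝 α)) : Tendsto u (upTo e) (upTo e) := by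
  have h0 := hg.tendsto_upTo
  conv => right; rw [hg.upTo_eq]
  rw [tendsto_comap_iff]
  have hev : (fun x => g (u x) / g x * g x) =ᶠ[upTo e] g ∘ u := by
    filter_upwards [hg.eventually_pos] with x hx
    simp [hx.ne']
  refine tendsto_nhdsWithin_iff.2 ⟨?_, ?_⟩
  · have := (hu.mul (tendsto_nhds_of_tendsto_nhdsWithin h0)).congr' hev
    simpa using this
  · filter_upwards [hu.eventually (lt_mem_nhds hα), hg.eventually_pos] with x hx hpos
    have := mul_pos hx hpos
    rwa [div_mul_cancel₀ _ hpos.ne'] at this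

variable {a : ℝ → ℝ}

theorem shift (hg : IsContSurvival g e) (h : GammaVarying g a (upTo e)) (t : ℝ) :
    Tendsto (fun x => x + a x * t) (upTo e) (upTo e) :=
  hg.tendsto_upTo_of_ratio (Real.exp_pos _) (h t)

theorem aux_div_tendsto_zero (hg : IsContSurvival g e) (h : GammaVarying g a (upTo e))
    (ha : ∀ x, 0 < a x) : Tendsto (fun x => a x / x) (upTo e) (𝓝 0) := by
  refine tendsto_order.2 ⟨fun b hb => ?_, fun b hb => ?_⟩
  · filter_upwards [hg.eventually_arg_pos] with x hx
    exact hb.trans (div_pos (ha x) hx)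
  -- The point `x - a x / b` still tends to `e`, so it is eventually positive, which says `a x / x <
  -- b`.
  · filter_upwards [hg.eventually_arg_pos,
      (hg.shift h (-b⁻¹)).eventually hg.eventually_arg_pos] with x hx h2
    rw [div_lt_iff₀ hx]
    have : 0 < b * (x + a x * -b⁻¹) := mul_pos hb h2
    have h3 : b * (x + a x * -b⁻¹) = b * x - a x := by field_simp; ring
    linarith

/-- Two auxiliary functions of the same survival function are equivalent. -/
theorem aux_unique (hg : IsContSurvival g e) (h : GammaVarying g a (upTo e))
    (ha : ∀ x, 0 < a x) {a' : ℝ → ℝ} {s : ℝ}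
    (h' : Tendsto (fun x => g (x + a x * s + a' x) / g x) (upTo e)
      (𝓝 (Real.exp (-(s + 1))))) :
    Tendsto (fun x => a' x / a x) (upTo e) (𝓝 1) := by
  refine tendsto_order.2 ⟨fun b hb => ?_, fun b hb => ?_⟩
  · filter_upwards [hg.eventually_lt_of_tendsto h' (h (s + b))
      (Real.exp_lt_exp.2 (by linarith))] with x hx
    rw [lt_div_iff₀ (ha x)]
    linarith [mul_add (a x) s b, mul_comm b (a x)]
  · filter_upwards [hg.eventually_lt_of_tendsto (h (s + b)) h'
      (Real.exp_lt_exp.2 (by linarith))] with x hx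
    rw [div_lt_iff₀ (ha x)]
    linarith [mul_add (a x) s b, mul_comm b (a x)]

/-- A further unit step on the scale `a (x + a x * s)` multiplies `g` by `e^{-1}` in the limit, as
does one on the scale `a x`; uniqueness of the scale at the shifted base point compares them. -/
theorem self_neglecting (hg : IsContSurvival g e) (h : GammaVarying g a (upTo e))
    (ha : ∀ x, 0 < a x) (s : ℝ) :
    Tendsto (fun x => a (x + a x * s) / a x) (upTo e) (𝓝 1) := by
  refine hg.aux_unique h ha (a' := fun x => a (x + a x * s)) (s := s) ?_
  have h1 := ((h 1).comp (hg.shift h s)).mul (h s)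
  rw [← Real.exp_add] at h1
  have h2 : -1 + -s = -(s + 1) := by ring
  rw [h2] at h1
  refine h1.congr' ?_
  filter_upwards [(hg.shift h s).eventually hg.eventually_pos] with x hx
  simp only [Function.comp, mul_one]
  rw [div_mul_div_cancel₀ hx.ne']

/-- `Γ`-variation is locally uniform. -/
theorem tendsto_ratio (hg : IsContSurvival g e) (h : GammaVarying g a (upTo e))
    (ha : ∀ x, 0 < a x) {u : ℝ → ℝ} {t : ℝ} (hu : Tendsto u (upTo e) (𝓝 t)) :
    Tendsto (fun x => g (x + a x * u x) / g x) (upTo e) (𝓝 (Real.exp (-t))) := by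
  have hc : ContinuousAt (fun s => Real.exp (-s)) t := by fun_prop
  refine tendsto_order.2 ⟨fun b hb => ?_, fun b hb => ?_⟩
  · obtain ⟨s, hs1, hs2⟩ := ((hc.eventually (lt_mem_nhds hb)).filter_mono
      (nhdsWithin_le_nhds (s := Ioi t)) |>.and self_mem_nhdsWithin).exists
    filter_upwards [(h s).eventually (lt_mem_nhds hs1),
      hu.eventually (gt_mem_nhds hs2)] with x h1 h2
    refine h1.trans_le (div_le_div_of_nonneg_right (hg.anti ?_) (hg.nonneg x))
    have := ha x
    gcongr
  · obtain ⟨s, hs1, hs2⟩ := ((hc.eventually (gt_mem_nhds hb)).filter_mono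
      (nhdsWithin_le_nhds (s := Iio t)) |>.and self_mem_nhdsWithin).exists
    filter_upwards [(h s).eventually (gt_mem_nhds hs1),
      hu.eventually (lt_mem_nhds hs2)] with x h1 h2
    refine (div_le_div_of_nonneg_right (hg.anti ?_) (hg.nonneg x)).trans_lt h1
    have := ha x
    gcongr

theorem gammaVarying_of_equiv (hg : IsContSurvival g e) (h : GammaVarying g a (upTo e))
    (ha : ∀ x, 0 < a x) {a' : ℝ → ℝ} (h' : Tendsto (fun x => a' x / a x) (upTo e) (𝓝 1)) :
    GammaVarying g a' (upTo e) := by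
  intro t
  have h1 : Tendsto (fun x => a' x / a x * t) (upTo e) (𝓝 t) := by
    simpa using h'.mul_const t
  refine (hg.tendsto_ratio h ha h1).congr fun x => ?_
  have := (ha x).ne'
  congr 3
  field_simp

/-- A Potter type bound. -/
theorem potter (hg : IsContSurvival g e) (h : GammaVarying g a (upTo e))
    (ha : ∀ x, 0 < a x) (p : ℕ) :
    ∃ δ > 0, ∀ᶠ x in upTo e, ∀ t, 0 ≤ t → g (x + a x * t) * (1 + δ * t) ^ p ≤ 2 * g x := by
  -- A step of length `a x` will at least halve `g`, while the weight grows by at most `(1 + δ) ^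
  -- p`; the choice makes this less than `2`.
  obtain ⟨δ, hδ2, hδ⟩ : ∃ δ : ℝ, (1 + δ) ^ p < 2 ∧ 0 < δ := by
    have hc : ContinuousAt (fun δ : ℝ => (1 + δ) ^ p) 0 := by fun_prop
    exact ((hc.eventually (gt_mem_nhds (show (1 + (0 : ℝ)) ^ p < 2 by simp))).filter_mono
      (nhdsWithin_le_nhds (s := Ioi 0)) |>.and self_mem_nhdsWithin).exists
  refine ⟨δ, hδ, ?_⟩
  have he : Real.exp (-1) < 1 / 2 := by
    rw [Real.exp_neg, inv_lt_comm₀ (Real.exp_pos _) (by norm_num)]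
    have := Real.exp_one_gt_d9
    norm_num; linarith
  have hev : ∀ᶠ x in upTo e, g (x + a x) ≤ g x / 2 ∧ a (x + a x) ≤ (1 + δ) * a x := by
    filter_upwards [(h 1).eventually (gt_mem_nhds he), hg.eventually_pos,
      (hg.self_neglecting h ha 1).eventually (gt_mem_nhds (show (1:ℝ) < 1 + δ by linarith))]
      with x h1 h2 h3
    rw [mul_one] at h1 h3
    rw [div_lt_iff₀ h2] at h1
    rw [div_lt_iff₀ (ha x)] at h3
    exact ⟨by linarith, h3.le⟩
  -- The eventual bounds become bounds on a region `0 < g x < r`. As `g` is antitone, moving right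
  -- preserves `g < r`, so the step can be iterated.
  rw [hg.upTo_eq] at hev
  have h0 : ∃ r > 0, ∀ x, 0 < g x → g x < r →
      g (x + a x) ≤ g x / 2 ∧ a (x + a x) ≤ (1 + δ) * a x := by
    rw [eventually_comap, eventually_nhdsWithin_iff, Metric.eventually_nhds_iff] at hev
    obtain ⟨r, hr, H⟩ := hev
    refine ⟨r, hr, fun x hx hxr => H (y := g x) ?_ hx x rfl⟩
    rwa [Real.dist_eq, sub_zero, abs_of_pos hx]
  obtain ⟨r, hr, H⟩ := h0
  -- `k` counts steps: passing to `x' = x + a x` replaces `t` by `t' = (t - 1) / (1 + δ)`, and `1 +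
  -- δ * t = (1 + δ) * (1 + δ * t')`.
  have key : ∀ k : ℕ, ∀ x, g x < r → ∀ t, 0 ≤ t → 1 + δ * t ≤ (1 + δ) ^ (k + 1) →
      g (x + a x * t) * (1 + δ * t) ^ p ≤ 2 * g x := by
    have small : ∀ x t, 0 ≤ t → t ≤ 1 → g (x + a x * t) * (1 + δ * t) ^ p ≤ 2 * g x := by
      intro x t ht ht1
      have h1 : g (x + a x * t) ≤ g x :=
        hg.anti (by have := mul_nonneg (ha x).le ht; linarith)
      have h2 : (1 + δ * t) ^ p ≤ 2 :=
        (pow_le_pow_left₀ (by positivity) (by nlinarith) p).trans hδ2.le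
      calc _ ≤ g x * 2 := mul_le_mul h1 h2 (by positivity) (hg.nonneg x)
        _ = _ := mul_comm _ _
    intro k
    induction k with
    | zero =>
      intro x _ t ht htk
      exact small x t ht (by simp at htk; nlinarith)
    | succ k ih =>
      intro x hx t ht htk
      rcases le_total t 1 with h1 | h1
      · exact small x t ht h1
      rcases (hg.nonneg x).eq_or_lt with h00 | hpos
      · have : g (x + a x * t) = 0 := le_antisymm
          (h00 ▸ hg.anti (by have := mul_nonneg (ha x).le ht; linarith)) (hg.nonneg _)
        rw [this, ← h00]; simp
      obtain ⟨hg2, ha2⟩ := H x hpos hx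
      set x' := x + a x
      set t' := (t - 1) / (1 + δ)
      have ht' : 0 ≤ t' := div_nonneg (by linarith) (by linarith)
      have e1 : 1 + δ * t = (1 + δ) * (1 + δ * t') := by
        simp only [t']; field_simp; ring
      have hle : 1 + δ * t' ≤ (1 + δ) ^ (k + 1) := by
        rw [e1, pow_succ' _ (k + 1)] at htk
        exact le_of_mul_le_mul_left htk (by linarith)
      have hxx : x' + a x' * t' ≤ x + a x * t := by
        have : a x' * t' ≤ (1 + δ) * a x * t' := mul_le_mul_of_nonneg_right ha2 ht'
        have h4 : (1 + δ) * a x * t' = a x * (t - 1) := by simp only [t']; field_simp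
        simp only [x'] at *
        linarith [mul_sub (a x) t 1]
      have hI := ih x' (by linarith) t' ht' hle
      calc g (x + a x * t) * (1 + δ * t) ^ p
          ≤ g (x' + a x' * t') * (1 + δ * t) ^ p :=
            mul_le_mul_of_nonneg_right (hg.anti hxx) (by positivity)
        _ = g (x' + a x' * t') * (1 + δ * t') ^ p * (1 + δ) ^ p := by rw [e1, mul_pow]; ring
        _ ≤ 2 * g x' * 2 := mul_le_mul hI hδ2.le (by positivity)
            (by have := hg.nonneg x'; linarith)
        _ ≤ 2 * g x := by linarith
  filter_upwards [hg.tendsto_upTo.eventually (mem_nhdsWithin_of_mem_nhds (gt_mem_nhds hr))]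
    with x hx t ht
  obtain ⟨k, hk⟩ := pow_unbounded_of_one_lt (1 + δ * t) (show 1 < 1 + δ by linarith)
  exact key k x hx t ht (hk.le.trans (pow_le_pow_right₀ (by linarith) (Nat.le_succ k)))

end IsContSurvival

/-! ### Integrals on the scale `a` and the mean excess function. -/

theorem integrableOn_Ioi_comp_affine {φ : ℝ → ℝ} {x c : ℝ} (hc : 0 < c) :
    IntegrableOn (fun u => φ (x + c * u)) (Ioi 0) ↔ IntegrableOn φ (Ioi x) := by
  have h1 : (Ioi (0 : ℝ)).indicator (fun u => φ (x + c * u)) =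
      fun u => (fun v => (Ioi x).indicator φ (x + v)) (c * u) := by
    ext u; simp [indicator, hc]
  rw [← integrable_indicator_iff measurableSet_Ioi, h1,
    integrable_comp_mul_left_iff (fun v => (Ioi x).indicator φ (x + v)) hc.ne',
    ← integrable_indicator_iff measurableSet_Ioi]
  exact ⟨fun h => by simpa using h.comp_add_left (-x), fun h => h.comp_add_left x⟩

theorem setIntegral_Ioi_comp_affine (φ : ℝ → ℝ) (x : ℝ) {c : ℝ} (hc : 0 < c) :
    ∫ s in Ioi x, φ s = c * ∫ u in Ioi 0, φ (x + c * u) := by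
  have h1 : (Ioi (0 : ℝ)).indicator (fun u => φ (x + c * u)) =
      fun u => (fun v => (Ioi x).indicator φ (x + v)) (c * u) := by
    ext u; simp [indicator, hc]
  rw [← integral_indicator measurableSet_Ioi, ← integral_indicator measurableSet_Ioi, h1,
    Measure.integral_comp_mul_left (fun v => (Ioi x).indicator φ (x + v)),
    integral_add_left_eq_self, abs_of_pos (inv_pos.2 hc), smul_eq_mul,
    mul_inv_cancel_left₀ (ne_of_gt hc)]

namespace IsContSurvival

variable {g : ℝ → ℝ} {e : EReal} {a : ℝ → ℝ}

theorem exists_bound (hg : IsContSurvival g e) (h : GammaVarying g a (upTo e))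
    (ha : ∀ x, 0 < a x) (j : ℕ) :
    ∃ B : ℝ → ℝ, IntegrableOn B (Ioi 0) ∧
      ∀ᶠ x in upTo e, ∀ u, 0 < u → u ^ j * (g (x + a x * u) / g x) ≤ B u := by
  -- Of the `j + 2` powers, `j` absorb `u ^ j` and two leave an integrable majorant.
  obtain ⟨δ, hδ, H⟩ := hg.potter h ha (j + 2)
  refine ⟨fun u => 2 * δ⁻¹ ^ j * (1 + (δ * u) ^ 2)⁻¹, ?_, ?_⟩
  · exact ((integrable_inv_one_add_sq.comp_mul_left' hδ.ne').const_mul _).integrableOn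
  filter_upwards [H, hg.eventually_pos] with x hx hpos u hu
  have h1 := hx u hu.le
  have h2 : 0 < 1 + δ * u := by positivity
  have h3 : g (x + a x * u) / g x ≤ 2 * ((1 + δ * u) ^ (j + 2))⁻¹ := by
    rw [div_le_iff₀ hpos, mul_right_comm, ← div_eq_mul_inv, le_div_iff₀ (by positivity)]
    exact h1
  have h4 : u ^ j ≤ δ⁻¹ ^ j * (1 + δ * u) ^ j := by
    rw [← mul_pow]
    refine pow_le_pow_left₀ hu.le ?_ j
    rw [inv_mul_eq_div, le_div_iff₀ hδ]; linarith
  have h5 : ((1 + δ * u) ^ 2)⁻¹ ≤ (1 + (δ * u) ^ 2)⁻¹ := by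
    apply inv_anti₀ (by positivity)
    have : 0 < δ * u := by positivity
    nlinarith
  calc u ^ j * (g (x + a x * u) / g x)
      ≤ (δ⁻¹ ^ j * (1 + δ * u) ^ j) * (2 * ((1 + δ * u) ^ (j + 2))⁻¹) :=
        mul_le_mul h4 h3 (div_nonneg (hg.nonneg _) hpos.le) (by positivity)
    _ = 2 * δ⁻¹ ^ j * ((1 + δ * u) ^ 2)⁻¹ := by
        rw [pow_add]; field_simp
    _ ≤ _ := by gcongr

theorem tendsto_integral (hg : IsContSurvival g e) (h : GammaVarying g a (upTo e))
    (ha : ∀ x, 0 < a x) (j : ℕ) {k : ℝ → ℝ → ℝ} {k₀ : ℝ → ℝ} {C : ℝ}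
    (hkm : ∀ x, Measurable (k x))
    (hkb : ∀ᶠ x in upTo e, ∀ u, 0 < u → |k x u| ≤ C * u ^ j)
    (hk : ∀ u, 0 < u → Tendsto (fun x => k x u) (upTo e) (𝓝 (k₀ u))) :
    Tendsto (fun x => ∫ u in Ioi 0, k x u * (g (x + a x * u) / g x)) (upTo e)
      (𝓝 (∫ u in Ioi 0, k₀ u * Real.exp (-u))) := by
  have := hg.isCountablyGenerated
  obtain ⟨B, hB, hBb⟩ := hg.exists_bound h ha j
  refine tendsto_integral_filter_of_dominated_convergence (fun u => |C| * B u) ?_ ?_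
    (hB.const_mul _) ?_
  · refine Eventually.of_forall fun x => ?_
    exact ((hkm x).mul (((hg.cont.comp (by fun_prop)).measurable).div_const _)).aestronglyMeasurable
  · filter_upwards [hkb, hBb] with x h1 h2
    refine (ae_restrict_iff' measurableSet_Ioi).2 (Eventually.of_forall fun u hu => ?_)
    have h4 : 0 ≤ g (x + a x * u) / g x := div_nonneg (hg.nonneg _) (hg.nonneg _)
    rw [norm_mul, Real.norm_eq_abs, Real.norm_eq_abs, abs_of_nonneg h4]
    calc |k x u| * (g (x + a x * u) / g x) ≤ C * u ^ j * (g (x + a x * u) / g x) :=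
          mul_le_mul_of_nonneg_right (h1 u hu) h4
      _ ≤ |C| * (u ^ j * (g (x + a x * u) / g x)) := by
          rw [mul_assoc]
          exact mul_le_mul_of_nonneg_right (le_abs_self C)
            (mul_nonneg (pow_nonneg (le_of_lt hu) j) h4)
      _ ≤ |C| * B u := mul_le_mul_of_nonneg_left (h2 u hu) (abs_nonneg C)
  · exact (ae_restrict_iff' measurableSet_Ioi).2 (Eventually.of_forall fun u hu =>
      (hk u hu).mul (h u))

/-- The majorant gives integrability beyond some point near `e`; continuity covers the remaining
compact interval. -/
theorem integrableOn_Ioi (hg : IsContSurvival g e) (h : GammaVarying g a (upTo e))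
    (ha : ∀ x, 0 < a x) (y : ℝ) : IntegrableOn g (Ioi y) := by
  obtain ⟨B, hB, hBb⟩ := hg.exists_bound h ha 0
  have hev : ∀ᶠ x in upTo e, IntegrableOn g (Ioi x) := by
    filter_upwards [hBb, hg.eventually_pos] with x hx hpos
    rw [← integrableOn_Ioi_comp_affine (ha x)]
    have : IntegrableOn (fun u => g (x + a x * u) / g x) (Ioi 0) := by
      refine hB.mono' ((hg.cont.comp (by fun_prop)).measurable.div_const _).aestronglyMeasurable ?_
      refine (ae_restrict_iff' measurableSet_Ioi).2 (Eventually.of_forall fun u hu => ?_)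
      rw [Real.norm_eq_abs, abs_of_nonneg (div_nonneg (hg.nonneg _) (hg.nonneg _))]
      simpa using hx u hu
    refine (this.mul_const (g x)).congr (Eventually.of_forall fun u => ?_)
    exact div_mul_cancel₀ _ hpos.ne'
  have hne : (upTo e).NeBot := by
    rw [hg.upTo_eq]
    refine comap_neBot_iff.2 fun t ht => ?_
    obtain ⟨r, hr, hrt⟩ := mem_nhdsGT_iff_exists_Ioc_subset.1 ht
    obtain ⟨z, hz⟩ := hg.exists_eq (p := min r 1) (lt_min hr one_pos) (min_le_right _ _)
    exact ⟨z, hrt (hz ▸ ⟨lt_min hr one_pos, min_le_left _ _⟩)⟩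
  obtain ⟨x, hx⟩ := hev.exists
  have h2 : IntegrableOn g (Icc y x) := hg.cont.continuousOn.integrableOn_compact isCompact_Icc
  refine (h2.union hx).mono_set fun z hz => ?_
  rcases le_or_gt z x with h3 | h3
  · exact Or.inl ⟨le_of_lt hz, h3⟩
  · exact Or.inr h3

theorem meanExcess_eq (hg : IsContSurvival g e) {G : ℝ → ℝ} (hG : ∀ x, 1 - G x = g x) (x : ℝ) :
    meanExcess e G x = (∫ t in Ioi x, g t) / g x := by
  unfold meanExcess
  simp only [hG]
  congr 1
  have : {t : ℝ | x < t ∧ (t : EReal) < e} = Ioi x ∩ {t | 0 < g t} := by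
    ext t; simp [hg.pos_iff]
  rw [this]
  refine (setIntegral_eq_of_subset_of_forall_sdiff_eq_zero measurableSet_Ioi
    inter_subset_left ?_).symm
  intro t ht
  by_contra h0
  exact ht.2 ⟨ht.1, lt_of_le_of_ne (hg.nonneg t) (Ne.symm h0)⟩

theorem tendsto_meanExcess (hg : IsContSurvival g e) (h : GammaVarying g a (upTo e))
    (ha : ∀ x, 0 < a x) {G : ℝ → ℝ} (hG : ∀ x, 1 - G x = g x) :
    Tendsto (fun x => meanExcess e G x / a x) (upTo e) (𝓝 1) := by
  have h1 := hg.tendsto_integral h ha 0 (k := fun _ _ => 1) (k₀ := fun _ => 1) (C := 1)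
    (fun _ => measurable_const) (by simp) (fun _ _ => tendsto_const_nhds)
  simp only [one_mul, integral_exp_neg_Ioi_zero] at h1
  refine h1.congr fun x => ?_
  rw [hg.meanExcess_eq hG, setIntegral_Ioi_comp_affine g x (ha x), integral_div]
  have := (ha x).ne'
  field_simp

theorem meanExcess_pos (hg : IsContSurvival g e) (h : GammaVarying g a (upTo e))
    (ha : ∀ x, 0 < a x) {G : ℝ → ℝ} (hG : ∀ x, 1 - G x = g x) {x : ℝ} (hx : (x : EReal) < e) :
    0 < meanExcess e G x := by
  rw [hg.meanExcess_eq hG]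
  have hpos := (hg.pos_iff x).1 hx
  refine div_pos ?_ hpos
  rw [setIntegral_pos_iff_support_of_nonneg_ae (Eventually.of_forall hg.nonneg)
    (hg.integrableOn_Ioi h ha x)]
  obtain ⟨y, hxy, hy⟩ : ∃ y, x < y ∧ 0 < g y := by
    have := ((hg.cont.continuousAt.eventually (lt_mem_nhds hpos)).filter_mono
      (nhdsWithin_le_nhds (s := Ioi x))).and self_mem_nhdsWithin
    obtain ⟨y, h1, h2⟩ := this.exists
    exact ⟨y, h2, h1⟩
  have hsub : Ioo x y ⊆ Function.support g ∩ Ioi x := fun z hz =>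
    ⟨(hy.trans_le (hg.anti hz.2.le)).ne', hz.1⟩
  refine lt_of_lt_of_le ?_ (measure_mono hsub)
  simpa using hxy

/-! ### The Gumbel domain and `Γ`-variation. -/

/-- Taking logarithms turns the power limit into `n * g (c n * x + b n) → e^{-x}`. The discrete
index is made continuous by `N y = ⌊1 / g y⌋`, so that `N y * g y → 1` and `c (N y)` serves as the
scale at `y`. -/
theorem gammaVarying_of_inMDA (hg : IsContSurvival g e) {G : ℝ → ℝ} (hG : ∀ x, 1 - G x = g x)
    (h : InMDA G gumbel) : ∃ a : ℝ → ℝ, (∀ x, 0 < a x) ∧ GammaVarying g a (upTo e) := by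
  obtain ⟨c, b, hc, H⟩ := h
  have hn : ∀ x, Tendsto (fun n : ℕ => n * g (c n * x + b n)) atTop (𝓝 (Real.exp (-x))) := by
    intro x
    have h1 := H x (by unfold gumbel; fun_prop)
    set p : ℕ → ℝ := fun n => G (c n * x + b n) with hp
    have hp0 : ∀ n, 0 ≤ p n := fun n => by
      have := hG (c n * x + b n); have := hg.le_one (c n * x + b n); simp only [hp]; linarith
    have hgp : ∀ n, g (c n * x + b n) = 1 - p n := fun n => (hG _).symm
    have hppos : ∀ᶠ n in atTop, 0 < p n := by
      filter_upwards [h1.eventually (lt_mem_nhds (Real.exp_pos _)), eventually_gt_atTop 0]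
        with n hn hn0
      refine (hp0 n).lt_of_ne fun h0 => ?_
      change 0 < p n ^ n at hn
      rw [← h0, zero_pow hn0.ne'] at hn
      exact hn.ne rfl
    have hlog : Tendsto (fun n : ℕ => n * Real.log (p n)) atTop (𝓝 (-Real.exp (-x))) := by
      have := h1.log (Real.exp_pos _).ne'
      simp only [gumbel, Real.log_exp, Real.log_pow] at this
      exact this
    have hlog0 : Tendsto (fun n : ℕ => Real.log (p n)) atTop (𝓝 0) := by
      have := hlog.mul tendsto_inv_atTop_nhds_zero_nat
      rw [mul_zero] at this
      refine this.congr' ?_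
      filter_upwards [eventually_gt_atTop 0] with n hn
      field_simp
    have hp1 : Tendsto p atTop (𝓝 1) := by
      have := (Real.continuous_exp.tendsto 0).comp hlog0
      rw [Real.exp_zero] at this
      refine this.congr' ?_
      filter_upwards [hppos] with n hn using Real.exp_log hn
    have hlow : Tendsto (fun n : ℕ => p n * -(n * Real.log (p n))) atTop (𝓝 (Real.exp (-x))) := by
      simpa using hp1.mul hlog.neg
    have hupp : Tendsto (fun n : ℕ => -(n * Real.log (p n))) atTop (𝓝 (Real.exp (-x))) := by
      simpa using hlog.neg
    -- Sandwich from `1 - 1 / p ≤ log p ≤ p - 1`.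
    refine tendsto_of_tendsto_of_tendsto_of_le_of_le' hlow hupp ?_ ?_
    · filter_upwards [hppos] with n hn
      have h2 := Real.one_sub_inv_le_log_of_pos hn
      have h3 := mul_le_mul_of_nonneg_left h2 hn.le
      rw [mul_sub, mul_inv_cancel₀ hn.ne', mul_one] at h3
      rw [hgp]
      nlinarith [Nat.cast_nonneg (α := ℝ) n]
    · filter_upwards [hppos] with n hn
      have h2 := Real.log_le_sub_one_of_pos hn
      rw [hgp]
      nlinarith [Nat.cast_nonneg (α := ℝ) n]
  have hinv : Tendsto (fun y => (g y)⁻¹) (upTo e) atTop :=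
    tendsto_inv_nhdsGT_zero.comp hg.tendsto_upTo
  set N : ℝ → ℕ := fun y => ⌊(g y)⁻¹⌋₊ with hN
  have hNtop : Tendsto N (upTo e) atTop := tendsto_nat_floor_atTop.comp hinv
  have hN1 : Tendsto (fun y => N y * g y) (upTo e) (𝓝 1) := by
    refine ((tendsto_nat_floor_div_atTop (R := ℝ)).comp hinv).congr fun y => ?_
    simp [hN]
  have hNg : ∀ x, Tendsto (fun y => g (c (N y) * x + b (N y)) / g y) (upTo e)
      (𝓝 (Real.exp (-x))) := by
    intro x
    have := ((hn x).comp hNtop).div hN1 one_ne_zero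
    rw [div_one] at this
    refine this.congr' ?_
    filter_upwards [hNtop.eventually (eventually_gt_atTop 0)] with y hy
    have : (0 : ℝ) < N y := by exact_mod_cast hy
    simp only [Function.comp, Pi.div_apply]
    rw [mul_div_mul_left _ _ this.ne']
  have hid : Tendsto (fun y => g y / g y) (upTo e) (𝓝 (Real.exp (-0))) := by
    rw [neg_zero, Real.exp_zero]
    refine tendsto_const_nhds.congr' ?_
    filter_upwards [hg.eventually_pos] with y hy using (div_self hy.ne').symm
  refine ⟨fun y => c (N y), fun y => hc _, fun t => ?_⟩
  have hcont : ContinuousAt (fun s => Real.exp (-s)) t := by fun_prop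
  -- `b (N y)` may differ from `y`, but comparing limits of `g` there and at `y` confines the gap to
  -- an arbitrarily small multiple of `c (N y)`.
  have hup : ∀ s, t < s → ∀ᶠ y in upTo e, y + c (N y) * t ≤ c (N y) * s + b (N y) := by
    intro s hs
    filter_upwards [hg.eventually_lt_of_tendsto (hNg (s - t)) hid
      (Real.exp_lt_exp.2 (by linarith))] with y hy
    linarith [mul_sub (c (N y)) s t]
  have hdown : ∀ s, s < t → ∀ᶠ y in upTo e, c (N y) * s + b (N y) ≤ y + c (N y) * t := by
    intro s hs
    filter_upwards [hg.eventually_lt_of_tendsto hid (hNg (s - t))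
      (Real.exp_lt_exp.2 (by linarith))] with y hy
    linarith [mul_sub (c (N y)) s t]
  refine tendsto_order.2 ⟨fun β hβ => ?_, fun β hβ => ?_⟩
  · obtain ⟨s, hs1, hs2⟩ := ((hcont.eventually (lt_mem_nhds hβ)).filter_mono
      (nhdsWithin_le_nhds (s := Ioi t)) |>.and self_mem_nhdsWithin).exists
    filter_upwards [(hNg s).eventually (lt_mem_nhds hs1), hup s hs2] with x h1 h2
    exact h1.trans_le (div_le_div_of_nonneg_right (hg.anti h2) (hg.nonneg x))
  · obtain ⟨s, hs1, hs2⟩ := ((hcont.eventually (gt_mem_nhds hβ)).filter_mono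
      (nhdsWithin_le_nhds (s := Iio t)) |>.and self_mem_nhdsWithin).exists
    filter_upwards [(hNg s).eventually (gt_mem_nhds hs1), hdown s hs2] with x h1 h2
    exact (div_le_div_of_nonneg_right (hg.anti h2) (hg.nonneg x)).trans_lt h1

/-- By continuity `b n` can be a quantile with `g (b n) = 1 / (n + 1)`, the shift covering `n = 0`.
With scale `a (b n)`, `n * g → e^{-x}`, and `(1 - z_n / n) ^ n → e^{-z}` when `z_n → z`. -/
theorem inMDA_of_gammaVarying (hg : IsContSurvival g e) {G : ℝ → ℝ} (hG : ∀ x, 1 - G x = g x)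
    (ha : ∀ x, 0 < a x) (h : GammaVarying g a (upTo e)) : InMDA G gumbel := by
  have hb : ∀ n : ℕ, ∃ y, g y = ((n : ℝ) + 1)⁻¹ := fun n =>
    hg.exists_eq (by positivity) (inv_le_one_of_one_le₀ (by linarith [Nat.cast_nonneg (α := ℝ) n]))
  choose b hb using hb
  have hbt : Tendsto b atTop (upTo e) := by
    rw [hg.upTo_eq, tendsto_comap_iff]
    refine tendsto_nhdsWithin_iff.2 ⟨?_, Eventually.of_forall fun n => ?_⟩
    · refine (tendsto_one_div_add_atTop_nhds_zero_nat (𝕜 := ℝ)).congr fun n => ?_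
      simp [hb]
    · simp only [Function.comp, hb, mem_Ioi]; positivity
  refine ⟨fun n => a (b n), b, fun n => ha _, fun x _ => ?_⟩
  have h1 := (h x).comp hbt
  have h2 : Tendsto (fun n : ℕ => (n : ℝ) * -g (a (b n) * x + b n)) atTop
      (𝓝 (-Real.exp (-x))) := by
    have h3 := (h1.mul (tendsto_natCast_div_add_atTop (1 : ℝ))).neg
    rw [mul_one] at h3
    refine h3.congr fun n => ?_
    simp only [Function.comp, hb]
    rw [add_comm (b n)]
    have : (n : ℝ) + 1 ≠ 0 := by positivity
    field_simp
  refine (Real.tendsto_one_add_pow_exp_of_tendsto h2).congr fun n => ?_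
  congr 1
  linarith [hG (a (b n) * x + b n)]

end IsContSurvival

/-! ### Monotone densities and transfer of differentiability. -/

/-- On `(0, ∞)`, the decrements of `g` over an interval are bounded by its length times the
values of `g₁` at the endpoints; so `g₁` is a non-increasing density of `-g`. -/
def IsDecrementDensity (g₁ g : ℝ → ℝ) : Prop :=
  ∀ x y, 0 < x → x < y → (y - x) * g₁ y ≤ g x - g y ∧ g x - g y ≤ (y - x) * g₁ x

namespace IsDecrementDensity

variable {g₁ g : ℝ → ℝ}

theorem antitoneOn (h : IsDecrementDensity g₁ g) : AntitoneOn g₁ (Ioi 0) := by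
  intro x hx y _ hxy
  rcases hxy.eq_or_lt with rfl | hlt
  · exact le_rfl
  · exact le_of_mul_le_mul_left ((h x y hx hlt).1.trans (h x y hx hlt).2) (sub_pos.2 hlt)

theorem slope_mem (h : IsDecrementDensity g₁ g) {x y : ℝ} (hx : 0 < x) (hy : 0 < y)
    (hxy : x ≠ y) : |slope g x y - -g₁ x| ≤ |g₁ y - g₁ x| := by
  have key : slope g x y ∈ uIcc (-g₁ x) (-g₁ y) := by
    rw [slope_def_field]
    rcases hxy.lt_or_gt with hlt | hlt
    · obtain ⟨h1, h2⟩ := h x y hx hlt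
      have hp := sub_pos.2 hlt
      refine mem_uIcc_of_le ?_ ?_
      · rw [le_div_iff₀ hp]; linarith
      · rw [div_le_iff₀ hp]; linarith
    · obtain ⟨h1, h2⟩ := h y x hy hlt
      have hp := sub_pos.2 hlt
      rw [← neg_div_neg_eq, neg_sub, neg_sub]
      refine mem_uIcc_of_ge ?_ ?_
      · rw [le_div_iff₀ hp]; linarith
      · rw [div_le_iff₀ hp]; linarith
  refine (abs_sub_left_of_mem_uIcc key).trans_eq ?_
  rw [neg_sub_neg, abs_sub_comm]

theorem hasDerivWithinAt (h : IsDecrementDensity g₁ g) {x : ℝ} (hx : 0 < x) {s : Set ℝ}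
    (hc : ContinuousWithinAt g₁ s x) : HasDerivWithinAt g (-g₁ x) s x := by
  rw [hasDerivWithinAt_iff_tendsto_slope, tendsto_iff_norm_sub_tendsto_zero]
  have h1 : Tendsto (fun y => |g₁ y - g₁ x|) (𝓝[s \ {x}] x) (𝓝 0) := by
    have h3 : Tendsto g₁ (𝓝[s \ {x}] x) (𝓝 (g₁ x)) := hc.mono sdiff_subset
    simpa using (h3.sub_const (g₁ x)).abs
  refine squeeze_zero' (Eventually.of_forall fun _ => norm_nonneg _) ?_ h1
  filter_upwards [self_mem_nhdsWithin, mem_nhdsWithin_of_mem_nhds (lt_mem_nhds hx)] with y hy hy0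
  exact h.slope_mem hx hy0 (Ne.symm hy.2)

theorem hasDerivAt (h : IsDecrementDensity g₁ g) {x : ℝ} (hx : 0 < x)
    (hc : ContinuousAt g₁ x) : HasDerivAt g (-g₁ x) x := by
  rw [← hasDerivWithinAt_univ]
  exact h.hasDerivWithinAt hx hc.continuousWithinAt

/-- Monotonicity bounds `g₁` near `x`, so `g` is locally Lipschitz even where `g₁` jumps. -/
theorem continuousAt (h : IsDecrementDensity g₁ g) {x : ℝ} (hx : 0 < x) : ContinuousAt g x := by
  have h1 : Tendsto (fun y => |y - x| * (|g₁ (x / 2)| + |g₁ (x + 1)|)) (𝓝 x) (𝓝 0) := by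
    have : ContinuousAt (fun y => |y - x| * (|g₁ (x / 2)| + |g₁ (x + 1)|)) x := by fun_prop
    simpa [ContinuousAt] using this
  rw [ContinuousAt, tendsto_iff_norm_sub_tendsto_zero]
  refine squeeze_zero' (Eventually.of_forall fun _ => norm_nonneg _) ?_ h1
  have hbd : ∀ z, x / 2 < z → z < x + 1 → |g₁ z| ≤ |g₁ (x / 2)| + |g₁ (x + 1)| := by
    intro z h1 h2
    have hz : 0 < z := by linarith
    have h3 := h.antitoneOn (half_pos hx) hz h1.le
    have h4 := h.antitoneOn hz (show 0 < x + 1 by linarith) h2.le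
    rw [abs_le]
    constructor
    · linarith [neg_abs_le (g₁ (x + 1)), abs_nonneg (g₁ (x / 2))]
    · linarith [le_abs_self (g₁ (x / 2)), abs_nonneg (g₁ (x + 1))]
  have hdec : ∀ y z, x / 2 < y → y < z → z < x + 1 →
      |g y - g z| ≤ (z - y) * (|g₁ (x / 2)| + |g₁ (x + 1)|) := by
    intro y z h1 h2 h3
    obtain ⟨h4, h5⟩ := h y z (by linarith) h2
    have hp := sub_pos.2 h2
    have h6 := abs_le.1 (hbd y h1 (by linarith))
    have h7 := abs_le.1 (hbd z (by linarith) h3)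
    rw [abs_le]
    constructor <;> nlinarith
  filter_upwards [lt_mem_nhds (half_lt_self hx), gt_mem_nhds (lt_add_one x)] with y h1 h2
  rw [Real.norm_eq_abs]
  rcases lt_trichotomy x y with hlt | rfl | hlt
  · rw [abs_of_pos (sub_pos.2 hlt), abs_sub_comm]
    exact hdec x y (by linarith) hlt h2
  · simp
  · rw [abs_sub_comm y x, abs_of_pos (sub_pos.2 hlt)]
    exact hdec y x h1 hlt (by linarith)

end IsDecrementDensity

/-- If the increments of `A` are those of `B` up to a factor between `w x` and `w y`, then `A` is
differentiable where `B` is. -/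
theorem hasDerivAt_of_increments_mem {A B w : ℝ → ℝ} {x b : ℝ}
    (h : ∀ᶠ y in 𝓝 x, A y - A x ∈ uIcc (w x * (B y - B x)) (w y * (B y - B x)))
    (hw : ContinuousAt w x) (hB : HasDerivAt B b x) : HasDerivAt A (w x * b) x := by
  rw [hasDerivAt_iff_tendsto_slope] at hB ⊢
  have h1 : Tendsto (fun y => |w y - w x| * |slope B x y|) (𝓝[≠] x) (𝓝 0) := by
    have h2 : Tendsto w (𝓝[≠] x) (𝓝 (w x)) := hw.tendsto.mono_left nhdsWithin_le_nhds
    simpa using (h2.sub_const (w x)).abs.mul hB.abs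
  have h3 : Tendsto (fun y => slope A x y - w x * slope B x y) (𝓝[≠] x) (𝓝 0) := by
    refine squeeze_zero_norm' ?_ h1
    filter_upwards [mem_nhdsWithin_of_mem_nhds h] with y hy
    have h4 := abs_sub_left_of_mem_uIcc hy
    rw [← sub_mul, abs_mul] at h4
    rw [slope_def_field, slope_def_field, Real.norm_eq_abs, abs_div, ← mul_div_assoc,
      ← mul_div_assoc, ← sub_div, abs_div]
    exact div_le_div_of_nonneg_right h4 (abs_nonneg _)
  have h5 := h3.add (hB.const_mul (w x))
  simpa using h5

theorem sub_mul_pow_le_pow_sub_pow {p q : ℝ} (hq : 0 ≤ q) (hqp : q ≤ p) (j : ℕ) :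
    (j + 1) * (p - q) * q ^ j ≤ p ^ (j + 1) - q ^ (j + 1) ∧
      p ^ (j + 1) - q ^ (j + 1) ≤ (j + 1) * (p - q) * p ^ j := by
  have hp := hq.trans hqp
  induction j with
  | zero => simp
  | succ j ih =>
    have h1 : p ^ (j + 1 + 1) - q ^ (j + 1 + 1) =
        p * (p ^ (j + 1) - q ^ (j + 1)) + (p - q) * q ^ (j + 1) := by ring
    have h2 := pow_le_pow_left₀ hq hqp (j + 1)
    have hd := sub_nonneg.2 hqp
    rw [h1]; push_cast
    constructor
    · have h3 : q * ((j + 1) * (p - q) * q ^ j) ≤ p * (p ^ (j + 1) - q ^ (j + 1)) :=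
        mul_le_mul hqp ih.1 (by positivity) hp
      calc _ = q * ((j + 1) * (p - q) * q ^ j) + (p - q) * q ^ (j + 1) := by ring
        _ ≤ _ := add_le_add_left h3 _
    · have h3 : p * (p ^ (j + 1) - q ^ (j + 1)) ≤ p * ((j + 1) * (p - q) * p ^ j) :=
        mul_le_mul_of_nonneg_left ih.2 hp
      have h4 := mul_le_mul_of_nonneg_left h2 hd
      calc _ ≤ p * ((j + 1) * (p - q) * p ^ j) + (p - q) * p ^ (j + 1) := add_le_add h3 h4
        _ = _ := by ring

/-! ### Partial moments of a finite measure. -/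

/-- The partial moments `∫_{(x, ∞)} t⁻ⁿ (t - x) ^ j dμ(t)`. -/
noncomputable def weightedTail (μ : Measure ℝ) (n j : ℕ) (x : ℝ) : ℝ :=
  ∫ t in Ioi x, t⁻¹ ^ n * (t - x) ^ j ∂μ

theorem weightedTail_eq (μ : Measure ℝ) (n j : ℕ) (x : ℝ) :
    weightedTail μ n j x = ∫ t, (Ioi x).indicator (fun t => t⁻¹ ^ n * (t - x) ^ j) t ∂μ :=
  (integral_indicator measurableSet_Ioi).symm

section weightedTail

variable {μ : Measure ℝ} [IsFiniteMeasure μ] {n j : ℕ}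

theorem weightedTail_integrableOn (hj : j ≤ n) {x : ℝ} (hx : 0 < x) :
    IntegrableOn (fun t => t⁻¹ ^ n * (t - x) ^ j) (Ioi x) μ := by
  refine Measure.integrableOn_of_bounded (M := x⁻¹ ^ (n - j)) (measure_ne_top _ _)
    (by measurability) ?_
  refine (ae_restrict_iff' measurableSet_Ioi).2 (Eventually.of_forall fun t ht => ?_)
  have ht0 : 0 < t := hx.trans ht
  have ht' : 0 < t - x := sub_pos.2 ht
  rw [Real.norm_eq_abs, abs_of_nonneg (by positivity), ← Nat.sub_add_cancel hj, pow_add,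
    Nat.add_sub_cancel, mul_assoc, ← mul_pow]
  have h1 : t⁻¹ * (t - x) ≤ 1 := by
    rw [inv_mul_eq_div, div_le_one ht0]; linarith
  calc _ ≤ x⁻¹ ^ (n - j) * 1 := by
        refine mul_le_mul ?_ (pow_le_one₀ (by positivity) h1) (by positivity) (by positivity)
        exact pow_le_pow_left₀ (by positivity) (inv_anti₀ hx (le_of_lt ht)) _
    _ = _ := mul_one _

theorem weightedTail_integrable_indicator (hj : j ≤ n) {x : ℝ} (hx : 0 < x) :
    Integrable ((Ioi x).indicator fun t => t⁻¹ ^ n * (t - x) ^ j) μ :=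
  (integrable_indicator_iff measurableSet_Ioi).2 (weightedTail_integrableOn hj hx)

/-- The inequalities hold for the integrand at each `t`: everything vanishes for `t ≤ x`, one
indicator survives for `x < t ≤ y`, where `t - x ≤ y - x`, and beyond `y` the mean value estimate
for powers applies. -/
theorem weightedTail_isDecrementDensity (hj : j + 1 ≤ n) :
    IsDecrementDensity (fun x => (j + 1) * weightedTail μ n j x) (weightedTail μ n (j + 1)) := by
  intro x y hx hxy
  have hy := hx.trans hxy
  have hp := sub_pos.2 hxy
  have ix := weightedTail_integrable_indicator (μ := μ) hj hx
  have iy := weightedTail_integrable_indicator (μ := μ) hj hy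
  have jx := weightedTail_integrable_indicator (μ := μ) ((Nat.le_succ j).trans hj) hx
  have jy := weightedTail_integrable_indicator (μ := μ) ((Nat.le_succ j).trans hj) hy
  simp only [weightedTail_eq, ← integral_const_mul]
  rw [← integral_sub ix iy]
  have pt : ∀ t, (y - x) * ((j + 1) * (Ioi y).indicator (fun t => t⁻¹ ^ n * (t - y) ^ j) t) ≤
      (Ioi x).indicator (fun t => t⁻¹ ^ n * (t - x) ^ (j + 1)) t -
        (Ioi y).indicator (fun t => t⁻¹ ^ n * (t - y) ^ (j + 1)) t ∧
      (Ioi x).indicator (fun t => t⁻¹ ^ n * (t - x) ^ (j + 1)) t -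
        (Ioi y).indicator (fun t => t⁻¹ ^ n * (t - y) ^ (j + 1)) t ≤
      (y - x) * ((j + 1) * (Ioi x).indicator (fun t => t⁻¹ ^ n * (t - x) ^ j) t) := by
    intro t
    rcases le_or_gt t x with h1 | h1
    · simp [indicator, not_lt.2 h1, not_lt.2 (h1.trans hxy.le)]
    have ht0 : 0 < t := hx.trans h1
    have hw : 0 ≤ t⁻¹ ^ n := by positivity
    have hd := sub_pos.2 h1
    rcases le_or_gt t y with h2 | h2
    · simp only [indicator, mem_Ioi, h1, not_lt.2 h2, if_true, if_false, mul_zero, sub_zero]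
      refine ⟨by positivity, ?_⟩
      have h3 : (t - x) ^ (j + 1) ≤ (y - x) * ((j + 1) * (t - x) ^ j) := by
        rw [pow_succ', ← mul_assoc]
        refine mul_le_mul_of_nonneg_right ?_ (by positivity)
        nlinarith [mul_nonneg hp.le (Nat.cast_nonneg (α := ℝ) j)]
      calc _ ≤ t⁻¹ ^ n * ((y - x) * ((j + 1) * (t - x) ^ j)) := mul_le_mul_of_nonneg_left h3 hw
        _ = _ := by ring
    · simp only [indicator, mem_Ioi, h1, h2, if_true]
      obtain ⟨h3, h4⟩ := sub_mul_pow_le_pow_sub_pow (p := t - x) (q := t - y)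
        (sub_pos.2 h2).le (by linarith) j
      rw [sub_sub_sub_cancel_left] at h3 h4
      rw [← mul_sub]
      constructor
      · calc _ = t⁻¹ ^ n * ((j + 1) * (y - x) * (t - y) ^ j) := by ring
          _ ≤ _ := mul_le_mul_of_nonneg_left h3 hw
      · calc _ ≤ t⁻¹ ^ n * ((j + 1) * (y - x) * (t - x) ^ j) := mul_le_mul_of_nonneg_left h4 hw
          _ = _ := by ring
  exact ⟨integral_mono ((jy.const_mul _).const_mul _) (ix.sub iy) fun t => (pt t).1,
    integral_mono (ix.sub iy) ((jx.const_mul _).const_mul _) fun t => (pt t).2⟩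

theorem weightedTail_zero_sub (n : ℕ) {x y : ℝ} (hx : 0 < x) (hxy : x < y) :
    y⁻¹ ^ n * μ.real (Ioc x y) ≤ weightedTail μ n 0 x - weightedTail μ n 0 y ∧
      weightedTail μ n 0 x - weightedTail μ n 0 y ≤ x⁻¹ ^ n * μ.real (Ioc x y) := by
  have hy := hx.trans hxy
  have ix := weightedTail_integrableOn (μ := μ) (Nat.zero_le n) hx
  have e1 : weightedTail μ n 0 x - weightedTail μ n 0 y = ∫ t in Ioc x y, t⁻¹ ^ n ∂μ := by
    simp only [weightedTail, pow_zero, mul_one] at ix ⊢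
    rw [← Ioc_union_Ioi_eq_Ioi hxy.le] at ix ⊢
    rw [setIntegral_union Ioc_disjoint_Ioi_same measurableSet_Ioi
      (ix.mono_set subset_union_left) (ix.mono_set subset_union_right)]
    ring
  have i0 : IntegrableOn (fun t : ℝ => t⁻¹ ^ n) (Ioc x y) μ := by
    simp only [pow_zero, mul_one] at ix
    exact ix.mono_set Ioc_subset_Ioi_self
  have e2 : ∀ c : ℝ, ∫ _ in Ioc x y, c ∂μ = c * μ.real (Ioc x y) := by
    intro c; simp [mul_comm]
  rw [e1, ← e2, ← e2]
  constructor
  · refine setIntegral_mono_on (integrableOn_const (measure_ne_top _ _)) i0 measurableSet_Ioc ?_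
    intro t ht
    exact pow_le_pow_left₀ (by positivity) (inv_anti₀ (hx.trans ht.1) ht.2) n
  · refine setIntegral_mono_on i0 (integrableOn_const (measure_ne_top _ _)) measurableSet_Ioc ?_
    intro t ht
    have := hx.trans ht.1
    exact pow_le_pow_left₀ (by positivity) (inv_anti₀ hx ht.1.le) n

theorem weightedTail_pos (hj : j ≤ n) {x : ℝ} (hx : 0 < x) (hμ : 0 < μ (Ioi x)) :
    0 < weightedTail μ n j x := by
  have hpos : ∀ t ∈ Ioi x, 0 < t⁻¹ ^ n * (t - x) ^ j := fun t ht => by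
    have h1 : 0 < t := hx.trans ht
    have h2 : 0 < t - x := sub_pos.2 ht
    positivity
  rw [weightedTail, setIntegral_pos_iff_support_of_nonneg_ae
    ((ae_restrict_iff' measurableSet_Ioi).2 (Eventually.of_forall fun t ht => (hpos t ht).le))
    (weightedTail_integrableOn hj hx)]
  exact hμ.trans_le (measure_mono fun t ht => ⟨ne_of_gt (hpos t ht), ht⟩)

/-- The tail mass is a binomial combination of the partial moments. -/
theorem tail_eq_sum_weightedTail (n : ℕ) {x : ℝ} (hx : 0 < x) :
    μ.real (Ioi x) =
      ∑ j ∈ Finset.range (n + 1), (n.choose j) * x ^ (n - j) * weightedTail μ n j x := by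
  simp only [weightedTail, ← integral_const_mul]
  rw [← integral_finsetSum _ fun j hj => (weightedTail_integrableOn
    (Nat.lt_succ_iff.1 (Finset.mem_range.1 hj)) hx).const_mul _]
  have h1 : ∫ _ in Ioi x, (1 : ℝ) ∂μ = μ.real (Ioi x) := by simp
  rw [← h1]
  refine setIntegral_congr_fun measurableSet_Ioi fun t ht => ?_
  have ht0 : 0 < t := hx.trans ht
  -- Expands `1 = t⁻¹ ^ n * ((t - x) + x) ^ n`.
  have h2 := add_pow (t - x) x n
  rw [sub_add_cancel] at h2
  calc (1 : ℝ) = t⁻¹ ^ n * t ^ n := by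
        rw [← mul_pow, inv_mul_cancel₀ ht0.ne', one_pow]
    _ = _ := by
        rw [h2, Finset.mul_sum]
        exact Finset.sum_congr rfl fun j _ => by ring

end weightedTail

/-! ### Derivatives of the Williamson transform. -/

section StieltjesFunction

variable {F : StieltjesFunction ℝ}

theorem StieltjesFunction.eq_zero_of_nonpos (hbot : Tendsto F atBot (𝓝 0)) (h0 : F 0 = 0) {x : ℝ}
    (hx : x ≤ 0) : F x = 0 :=
  le_antisymm (h0 ▸ F.mono hx) (F.mono.le_of_tendsto hbot x)

theorem StieltjesFunction.continuous_of_differentiableOn (hbot : Tendsto F atBot (𝓝 0))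
    (h0 : F 0 = 0) (h : DifferentiableOn ℝ F (Ioi 0)) : Continuous F := by
  refine continuous_iff_continuousAt.2 fun x => ?_
  rcases lt_or_ge 0 x with hx | hx
  · exact (h.differentiableAt (Ioi_mem_nhds hx)).continuousAt
  · refine continuousAt_iff_continuous_left'_right'.2 ⟨?_, ?_⟩
    · refine (continuousWithinAt_const (b := (0 : ℝ))).congr (fun y hy => ?_) ?_
      · exact F.eq_zero_of_nonpos hbot h0 ((le_of_lt hy).trans hx)
      · exact F.eq_zero_of_nonpos hbot h0 hx
    · exact (F.right_continuous x).mono Ioi_subset_Ici_self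

theorem StieltjesFunction.measureReal_Ioc {x y : ℝ} (h : x ≤ y) :
    F.measure.real (Ioc x y) = F y - F x := by
  rw [Measure.real, F.measure_Ioc, ENNReal.toReal_ofReal (sub_nonneg.2 (F.mono h))]

theorem StieltjesFunction.measureReal_Ioi (htop : Tendsto F atTop (𝓝 1)) (x : ℝ) :
    F.measure.real (Ioi x) = 1 - F x := by
  rw [Measure.real, F.measure_Ioi htop,
    ENNReal.toReal_ofReal (sub_nonneg.2 (F.mono.ge_of_tendsto htop x))]

theorem williamson_eq_weightedTail (d : ℕ) {x : ℝ} (hx : 0 < x) :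
    williamson d F x = weightedTail F.measure (d - 1) (d - 1) x := by
  refine setIntegral_congr_fun measurableSet_Ioi fun t ht => ?_
  have : 0 < t := hx.trans ht
  rw [← mul_pow]
  congr 1
  field_simp

section Derivatives

variable [IsFiniteMeasure F.measure] {n : ℕ}

/-- Each differentiation lowers the moment index by one. For `k < n` the index stays positive, where
the moment is continuous and the derivative two-sided. -/
theorem iteratedDeriv_williamson {k : ℕ} (hk : k < n) {x : ℝ} (hx : 0 < x) :
    iteratedDeriv k (williamson (n + 1) F) x =
      (-1) ^ k * n.descFactorial k * weightedTail F.measure n (n - k) x := by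
  induction k generalizing x with
  | zero => simpa using williamson_eq_weightedTail (F := F) (n + 1) hx
  | succ k ih =>
    rw [iteratedDeriv_succ]
    have hev : iteratedDeriv k (williamson (n + 1) F) =ᶠ[𝓝 x] fun x =>
        (-1) ^ k * n.descFactorial k * weightedTail F.measure n (n - k) x := by
      filter_upwards [lt_mem_nhds hx] with y hy using ih (by omega) hy
    rw [hev.deriv_eq]
    obtain ⟨i, hi⟩ : ∃ i, n = k + 1 + (i + 1) := ⟨n - k - 2, by omega⟩
    have e1 : n - k = i + 1 + 1 := by omega
    have e2 : n - (k + 1) = i + 1 := by omega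
    have hc : ContinuousAt (weightedTail F.measure n (i + 1)) x :=
      (weightedTail_isDecrementDensity (by omega)).continuousAt hx
    have hder := (weightedTail_isDecrementDensity (μ := F.measure) (n := n) (j := i + 1)
      (by omega)).hasDerivAt hx (hc.const_mul _)
    rw [e1, e2, Nat.descFactorial_succ, e1, (hder.const_mul _).deriv, pow_succ]
    push_cast
    ring

/-- At index `0` the moment jumps with `F` and is only right-continuous, so the last derivative is
taken from the right. -/
theorem williamsonTopDeriv_eq (hn : 1 ≤ n) {x : ℝ} (hx : 0 < x) :
    williamsonTopDeriv (n + 1) F x =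
      (-1) ^ n * n.factorial * weightedTail F.measure n 0 x := by
  obtain ⟨m, rfl⟩ : ∃ m, n = m + 1 := ⟨n - 1, by omega⟩
  unfold williamsonTopDeriv
  have e0 : m + 1 + 1 - 2 = m := by omega
  have e1 : m + 1 - m = 0 + 1 := by omega
  rw [e0]
  have hEq : ∀ y, 0 < y → iteratedDeriv m (williamson (m + 1 + 1) F) y =
      (-1) ^ m * (m + 1).descFactorial m * weightedTail F.measure (m + 1) (0 + 1) y := by
    intro y hy
    rw [iteratedDeriv_williamson (Nat.lt_succ_self m) hy, e1]
  rw [derivWithin_congr (s := Ioi x) (fun y hy => hEq y (hx.trans hy)) (hEq x hx)]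
  have hrc : ContinuousWithinAt (weightedTail F.measure (m + 1) 0) (Ioi x) x := by
    have h1 : Tendsto (fun y => x⁻¹ ^ (m + 1) * (F y - F x)) (𝓝[>] x) (𝓝 0) := by
      have h2 : Tendsto F (𝓝[>] x) (𝓝 (F x)) :=
        (F.right_continuous x).mono Ioi_subset_Ici_self
      simpa using (h2.sub_const (F x)).const_mul (x⁻¹ ^ (m + 1))
    rw [ContinuousWithinAt, tendsto_iff_norm_sub_tendsto_zero]
    refine squeeze_zero' (Eventually.of_forall fun _ => norm_nonneg _) ?_ h1
    filter_upwards [self_mem_nhdsWithin] with y hy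
    obtain ⟨h3, h4⟩ := weightedTail_zero_sub (μ := F.measure) (m + 1) hx hy
    have hy0 : 0 < y := hx.trans hy
    rw [F.measureReal_Ioc (le_of_lt hy)] at h3 h4
    have h5 : 0 ≤ y⁻¹ ^ (m + 1) * (F y - F x) :=
      mul_nonneg (by positivity) (sub_nonneg.2 (F.mono (le_of_lt hy)))
    rw [norm_sub_rev, Real.norm_eq_abs, abs_of_nonneg (h5.trans h3)]
    exact h4
  have hder := (weightedTail_isDecrementDensity (μ := F.measure) (n := m + 1) (j := 0)
    (by omega)).hasDerivWithinAt hx (continuousWithinAt_const.mul hrc)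
  rw [(hder.const_mul _).derivWithin (uniqueDiffWithinAt_Ioi x), pow_succ, Nat.factorial_succ]
  have h6 : (m + 1).descFactorial m = (m + 1).factorial := by
    have := Nat.factorial_mul_descFactorial (Nat.le_succ m)
    simpa using this
  rw [h6, Nat.factorial_succ]
  push_cast
  ring

theorem weightedTail_increments (n : ℕ) {x y : ℝ} (hx : 0 < x) (hy : 0 < y) :
    weightedTail F.measure n 0 y - weightedTail F.measure n 0 x ∈
      uIcc (-x⁻¹ ^ n * (F y - F x)) (-y⁻¹ ^ n * (F y - F x)) := by
  rcases lt_trichotomy x y with h | rfl | h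
  · obtain ⟨h1, h2⟩ := weightedTail_zero_sub (μ := F.measure) n hx h
    rw [F.measureReal_Ioc h.le] at h1 h2
    exact mem_uIcc_of_le (by linarith) (by linarith)
  · simp
  · obtain ⟨h1, h2⟩ := weightedTail_zero_sub (μ := F.measure) n hy h
    rw [F.measureReal_Ioc h.le] at h1 h2
    exact mem_uIcc_of_le (by linarith) (by linarith)

theorem increments_weightedTail (n : ℕ) {x y : ℝ} (hx : 0 < x) (hy : 0 < y) :
    F y - F x ∈
      uIcc (-x ^ n * (weightedTail F.measure n 0 y - weightedTail F.measure n 0 x))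
        (-y ^ n * (weightedTail F.measure n 0 y - weightedTail F.measure n 0 x)) := by
  have key : ∀ z : ℝ, 0 < z → ∀ D, z ^ n * (z⁻¹ ^ n * D) = D := by
    intro z hz D
    rw [← mul_assoc, ← mul_pow, mul_inv_cancel₀ hz.ne', one_pow, one_mul]
  rcases lt_trichotomy x y with h | rfl | h
  · obtain ⟨h1, h2⟩ := weightedTail_zero_sub (μ := F.measure) n hx h
    rw [F.measureReal_Ioc h.le] at h1 h2
    have h3 := mul_le_mul_of_nonneg_left h1 (pow_pos hy n).le
    have h4 := mul_le_mul_of_nonneg_left h2 (pow_pos hx n).le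
    rw [key y hy] at h3
    rw [key x hx] at h4
    exact mem_uIcc_of_le (by linarith) (by linarith)
  · simp
  · obtain ⟨h1, h2⟩ := weightedTail_zero_sub (μ := F.measure) n hy h
    rw [F.measureReal_Ioc h.le] at h1 h2
    have h3 := mul_le_mul_of_nonneg_left h1 (pow_pos hx n).le
    have h4 := mul_le_mul_of_nonneg_left h2 (pow_pos hy n).le
    rw [key x hx] at h3
    rw [key y hy] at h4
    exact mem_uIcc_of_le (by linarith) (by linarith)

theorem differentiableOn_iff_williamsonTopDeriv (hn : 1 ≤ n) :
    DifferentiableOn ℝ F (Ioi 0) ↔ DifferentiableOn ℝ (williamsonTopDeriv (n + 1) F) (Ioi 0) := by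
  have hc : ((-1 : ℝ) ^ n * n.factorial) ≠ 0 :=
    mul_ne_zero (pow_ne_zero _ (by norm_num)) (by exact_mod_cast n.factorial_ne_zero)
  constructor
  · intro h x hx
    have hF := (h.differentiableAt (Ioi_mem_nhds hx)).hasDerivAt
    have hx0 : x ≠ 0 := ne_of_gt hx
    have hG := hasDerivAt_of_increments_mem (A := weightedTail F.measure n 0)
      (w := fun z => -z⁻¹ ^ n)
      ((lt_mem_nhds hx).mono fun y hy => weightedTail_increments n hx hy)
      (by fun_prop (disch := assumption)) hF
    refine DifferentiableAt.differentiableWithinAt ?_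
    refine (hG.differentiableAt.const_mul ((-1) ^ n * n.factorial)).congr_of_eventuallyEq ?_
    filter_upwards [lt_mem_nhds hx] with y hy using williamsonTopDeriv_eq hn hy
  · intro h x hx
    have hT := h.differentiableAt (Ioi_mem_nhds hx)
    have hG : DifferentiableAt ℝ (weightedTail F.measure n 0) x := by
      refine (hT.const_mul ((-1) ^ n * n.factorial : ℝ)⁻¹).congr_of_eventuallyEq ?_
      filter_upwards [lt_mem_nhds hx] with y hy
      rw [williamsonTopDeriv_eq hn hy, inv_mul_cancel_left₀ hc]
    have hF := hasDerivAt_of_increments_mem (A := F) (w := fun z => -z ^ n)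
      ((lt_mem_nhds hx).mono fun y hy => increments_weightedTail n hx hy)
      (by fun_prop) hG.hasDerivAt
    exact hF.differentiableAt.differentiableWithinAt

end Derivatives

end StieltjesFunction

/-! ### The survival function `ψ` and its endpoint. -/

theorem coe_lt_rightEndpoint_iff {G : ℝ → ℝ} (hc : Continuous G) (hm : Monotone G) (x : ℝ) :
    (x : EReal) < rightEndpoint G ↔ G x < 1 := by
  unfold rightEndpoint
  rw [lt_sSup_iff]
  constructor
  · rintro ⟨_, ⟨y, hy, rfl⟩, hxy⟩
    exact (hm (EReal.coe_lt_coe_iff.1 hxy).le).trans_lt hy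
  · intro hx
    have := ((hc.continuousAt.eventually (gt_mem_nhds hx)).filter_mono
      (nhdsWithin_le_nhds (s := Ioi x))).and self_mem_nhdsWithin
    obtain ⟨y, h1, h2⟩ := this.exists
    exact ⟨_, ⟨y, h1, rfl⟩, EReal.coe_lt_coe_iff.2 h2⟩

section Survival

variable {F : StieltjesFunction ℝ} {d : ℕ}

theorem StieltjesFunction.isContSurvival (hbot : Tendsto F atBot (𝓝 0))
    (htop : Tendsto F atTop (𝓝 1)) (h0 : F 0 = 0) (hc : Continuous F) :
    IsContSurvival (fun x => 1 - F x) (rightEndpoint F) where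
  cont := continuous_const.sub hc
  anti := fun _ _ h => sub_le_sub_left (F.mono h) 1
  eq_one := fun x hx => by simp [F.eq_zero_of_nonpos hbot h0 hx]
  nonneg := fun x => sub_nonneg.2 (F.mono.ge_of_tendsto htop x)
  tendsto_zero := by simpa using htop.const_sub 1
  pos_iff := fun x => by rw [coe_lt_rightEndpoint_iff hc F.mono, sub_pos]

/-- Truncating the kernel fixes the domain of integration; monotonicity and continuity in `x` can
then be read off the integrand. -/
theorem one_sub_williamsonDF_eq (hd : 2 ≤ d) (htop : Tendsto F atTop (𝓝 1)) (h0 : F 0 = 0)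
    (x : ℝ) : 1 - williamsonDF d F x =
      ∫ t in Ioi 0, (max 0 (1 - max x 0 / t)) ^ (d - 1) ∂F.measure := by
  unfold williamsonDF
  split_ifs with hx
  · have := F.measureReal_Ioi htop 0
    rw [max_eq_right hx.le]
    simp [this, h0]
  · push Not at hx
    rw [max_eq_left hx, sub_sub_cancel, williamson]
    symm
    have h1 : ∫ t in Ioi x, (1 - x / t) ^ (d - 1) ∂F.measure =
        ∫ t in Ioi x, (max 0 (1 - x / t)) ^ (d - 1) ∂F.measure := by
      refine setIntegral_congr_fun measurableSet_Ioi fun t ht => ?_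
      have : x / t ≤ 1 := (div_le_one (hx.trans_lt ht)).2 (le_of_lt ht)
      rw [max_eq_right (sub_nonneg.2 this)]
    rw [h1]
    refine setIntegral_eq_of_subset_of_forall_sdiff_eq_zero measurableSet_Ioi
      (Ioi_subset_Ioi hx) ?_
    rintro t ⟨ht, htx⟩
    have ht0 : (0 : ℝ) < t := ht
    have : 1 ≤ x / t := (one_le_div ht0).2 (not_lt.1 htx)
    rw [max_eq_left (by linarith), zero_pow (by omega)]

theorem isContSurvival_williamsonDF (hd : 2 ≤ d) (hbot : Tendsto F atBot (𝓝 0))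
    (htop : Tendsto F atTop (𝓝 1)) (h0 : F 0 = 0) (hc : Continuous F) :
    IsContSurvival (fun x => 1 - williamsonDF d F x) (rightEndpoint F) := by
  have : IsProbabilityMeasure F.measure := F.isProbabilityMeasure hbot htop
  have hF := F.isContSurvival hbot htop h0 hc
  have hk01 : ∀ x t : ℝ, 0 < t → 0 ≤ max 0 (1 - max x 0 / t) ∧ max 0 (1 - max x 0 / t) ≤ 1 :=
    fun x t ht => ⟨le_max_left _ _, max_le zero_le_one
      (sub_le_self _ (div_nonneg (le_max_right _ _) ht.le))⟩
  have hmeas : ∀ x : ℝ, Measurable fun t : ℝ => (max 0 (1 - max x 0 / t)) ^ (d - 1) := by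
    intro x; fun_prop
  have hint : ∀ x : ℝ, IntegrableOn (fun t : ℝ => (max 0 (1 - max x 0 / t)) ^ (d - 1)) (Ioi 0)
      F.measure := by
    intro x
    refine Measure.integrableOn_of_bounded (M := 1) (measure_ne_top _ _)
      (hmeas x).aestronglyMeasurable ?_
    refine (ae_restrict_iff' measurableSet_Ioi).2 (Eventually.of_forall fun t ht => ?_)
    obtain ⟨h1, h2⟩ := hk01 x t ht
    rw [Real.norm_eq_abs, abs_of_nonneg (pow_nonneg h1 _)]
    exact pow_le_one₀ h1 h2
  have eq_one : ∀ x ≤ 0, 1 - williamsonDF d F x = 1 := by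
    intro x hx
    rw [one_sub_williamsonDF_eq hd htop h0, max_eq_right hx]
    simp [F.measureReal_Ioi htop 0, h0]
  have anti : Antitone fun x => 1 - williamsonDF d F x := by
    intro x y hxy
    simp only [one_sub_williamsonDF_eq hd htop h0]
    refine setIntegral_mono_on (hint y) (hint x) measurableSet_Ioi fun t ht => ?_
    have ht0 : (0 : ℝ) < t := ht
    refine pow_le_pow_left₀ (le_max_left _ _) ?_ _
    gcongr
  -- Since the kernel lies in `(0, 1]` on `t > x > 0`, `ψ` is dominated by the tail of `F` and is
  -- positive exactly where that tail is.
  have hle : ∀ x, 1 - williamsonDF d F x ≤ 1 - F x := by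
    intro x
    rcases le_or_gt x 0 with hx | hx
    · rw [eq_one x hx, F.eq_zero_of_nonpos hbot h0 hx, sub_zero]
    · rw [← F.measureReal_Ioi htop]
      have h1 : ∫ _ in Ioi x, (1 : ℝ) ∂F.measure = F.measure.real (Ioi x) := by simp
      rw [williamsonDF, if_neg (not_lt.2 hx.le), sub_sub_cancel, ← h1,
        williamson_eq_weightedTail d hx]
      refine setIntegral_mono_on (weightedTail_integrableOn le_rfl hx)
        (integrableOn_const (measure_ne_top _ _)) measurableSet_Ioi fun t ht => ?_
      have ht0 : 0 < t := hx.trans ht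
      rw [← mul_pow]
      refine pow_le_one₀ (mul_nonneg (by positivity) (sub_pos.2 ht).le) ?_
      rw [inv_mul_eq_div, div_le_one ht0]; linarith
  have nonneg : ∀ x, 0 ≤ 1 - williamsonDF d F x := by
    intro x
    rw [one_sub_williamsonDF_eq hd htop h0]
    exact setIntegral_nonneg measurableSet_Ioi fun t _ => pow_nonneg (le_max_left _ _) _
  refine ⟨?_, anti, eq_one, nonneg, ?_, fun x => ?_⟩
  · simp only [one_sub_williamsonDF_eq hd htop h0]
    refine continuous_of_dominated (bound := fun _ => 1)
      (fun x => (hmeas x).aestronglyMeasurable) (fun x => ?_) (integrable_const _) ?_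
    · refine (ae_restrict_iff' measurableSet_Ioi).2 (Eventually.of_forall fun t ht => ?_)
      obtain ⟨h1, h2⟩ := hk01 x t ht
      rw [Real.norm_eq_abs, abs_of_nonneg (pow_nonneg h1 _)]
      exact pow_le_one₀ h1 h2
    · exact Eventually.of_forall fun t => by fun_prop
  · exact squeeze_zero nonneg hle hF.tendsto_zero
  · rw [hF.pos_iff]
    refine ⟨fun h => ?_, fun h => h.trans_le (hle x)⟩
    rcases le_or_gt x 0 with hx | hx
    · rw [eq_one x hx]; exact one_pos
    · rw [williamsonDF, if_neg (not_lt.2 hx.le), sub_sub_cancel, williamson_eq_weightedTail d hx]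
      refine weightedTail_pos le_rfl hx ?_
      rwa [F.measure_Ioi htop, ENNReal.ofReal_pos]

theorem rightEndpoint_williamsonDF (hd : 2 ≤ d) (hbot : Tendsto F atBot (𝓝 0))
    (htop : Tendsto F atTop (𝓝 1)) (h0 : F 0 = 0) (hc : Continuous F) :
    rightEndpoint (williamsonDF d F) = rightEndpoint F := by
  have h1 := isContSurvival_williamsonDF hd hbot htop h0 hc
  have h2 := F.isContSurvival hbot htop h0 hc
  have : {x : ℝ | williamsonDF d F x < 1} = {x : ℝ | F x < 1} := by
    ext x
    rw [mem_ofPred_eq, mem_ofPred_eq, ← sub_pos, ← sub_pos (b := F x)]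
    exact (h1.pos_iff x).symm.trans (h2.pos_iff x)
  rw [rightEndpoint, this, rightEndpoint]

/-- Integration by parts for the Williamson transform. -/
theorem williamson_eq_integral (n : ℕ) (hbot : Tendsto F atBot (𝓝 0))
    (htop : Tendsto F atTop (𝓝 1)) (h0 : F 0 = 0) {x : ℝ} (hx : 0 < x) :
    williamson (n + 2) F x =
      ∫ s in Ioi x, (n + 1) * (1 - x / s) ^ n * (x / s ^ 2) * (1 - F s) := by
  have : IsProbabilityMeasure F.measure := F.isProbabilityMeasure hbot htop
  set q : ℝ → ℝ := fun s => (n + 1) * (1 - x / s) ^ n * (x / s ^ 2) with hq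
  have hqm : Measurable q := by fun_prop
  have hu : ∀ s, x < s → 0 ≤ 1 - x / s ∧ 1 - x / s ≤ 1 := fun s hs => by
    have hs0 := hx.trans hs
    exact ⟨sub_nonneg.2 ((div_le_one hs0).2 hs.le), sub_le_self _ (by positivity)⟩
  have hq0 : ∀ s, x < s → 0 ≤ q s := fun s hs =>
    mul_nonneg (mul_nonneg (by positivity) (pow_nonneg (hu s hs).1 n)) (by positivity)
  have hqb : ∀ s, x < s → q s ≤ (n + 1) * 1 * (x / x ^ 2) := fun s hs => by
    have hs0 := hx.trans hs
    simp only [hq]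
    have := pow_le_one₀ (n := n) (hu s hs).1 (hu s hs).2
    have := pow_nonneg (hu s hs).1 n
    gcongr
  have hI : ∀ ω : ℝ, 0 ≤ ω → ∫ t in (0 : ℝ)..ω, (Ioi x).indicator q t =
      (Ioi x).indicator (fun ω => (1 - x / ω) ^ (n + 1)) ω := by
    intro ω hω
    rw [intervalIntegral.integral_of_le hω, setIntegral_indicator measurableSet_Ioi]
    rcases le_or_gt ω x with h | h
    · have : Ioc 0 ω ∩ Ioi x = ∅ := by
        ext t; simp only [mem_inter_iff, mem_Ioc, mem_Ioi, mem_empty_iff_false, iff_false]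
        intro ht; linarith [ht.1.2, ht.2]
      rw [this, indicator_of_notMem (show ω ∉ Ioi x from not_lt.2 h)]
      simp
    · have : Ioc 0 ω ∩ Ioi x = Ioc x ω := by
        ext t; simp only [mem_inter_iff, mem_Ioc, mem_Ioi]
        exact ⟨fun ht => ⟨ht.2, ht.1.2⟩, fun ht => ⟨⟨hx.trans ht.1, ht.2⟩, ht.1⟩⟩
      rw [this, indicator_of_mem (show ω ∈ Ioi x from h), ← intervalIntegral.integral_of_le h.le]
      have hne : ∀ s ∈ uIcc x ω, s ≠ 0 := fun s hs => by
        rw [uIcc_of_le h.le] at hs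
        exact (hx.trans_le hs.1).ne'
      rw [intervalIntegral.integral_eq_sub_of_hasDerivAt (f := fun s => (1 - x / s) ^ (n + 1))]
      · simp [hx.ne']
      · intro s hs
        have hs0 := hne s hs
        have h1 : HasDerivAt (fun s => 1 - x / s) (x / s ^ 2) s := by
          have := ((hasDerivAt_inv hs0).const_mul x).const_sub 1
          simp only [← div_eq_mul_inv] at this
          refine this.congr_deriv ?_
          field_simp
        refine (h1.pow (n + 1)).congr_deriv ?_
        simp [hq]
      · refine ContinuousOn.intervalIntegrable ?_
        have hne2 : ∀ s ∈ uIcc x ω, s ^ 2 ≠ 0 := fun s hs => pow_ne_zero 2 (hne s hs)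
        simp only [hq]
        fun_prop (disch := assumption)
  have hnn : 0 ≤ᵐ[F.measure] (fun ω : ℝ => ω) := by
    have : F.measure (Iic 0) = 0 := by rw [F.measure_Iic hbot]; simp [h0]
    rw [EventuallyLE, ae_iff]
    refine measure_mono_null (fun ω hω => ?_) this
    exact (not_le.1 hω).le
  have hind0 : ∀ t, 0 ≤ (Ioi x).indicator q t := indicator_nonneg hq0
  -- Layer cake formula for the kernel, which is the primitive of `q` cut off at `x`. It is an
  -- identity of `lintegral`s, so no integrability is needed.
  have hlc := lintegral_comp_eq_lintegral_meas_lt_mul F.measure hnn aemeasurable_id'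
    (g := (Ioi x).indicator q) (fun t ht => by
      rw [intervalIntegrable_iff]
      refine Measure.integrableOn_of_bounded (M := (n + 1) * 1 * (x / x ^ 2))
        (by simp) (hqm.indicator measurableSet_Ioi).aestronglyMeasurable
        (Eventually.of_forall fun s => ?_)
      rw [Real.norm_eq_abs, abs_of_nonneg (hind0 s)]
      exact indicator_apply_le' (fun hs => hqb s hs) (fun _ => by positivity))
    (Eventually.of_forall hind0)
  have hL : ∫⁻ ω, ENNReal.ofReal (∫ t in (0 : ℝ)..ω, (Ioi x).indicator q t) ∂F.measure =
      ∫⁻ t in Ioi x, ENNReal.ofReal ((1 - x / t) ^ (n + 1)) ∂F.measure := by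
    rw [← lintegral_indicator measurableSet_Ioi]
    refine lintegral_congr_ae ?_
    filter_upwards [hnn] with ω hω
    rw [hI ω hω]
    by_cases h : ω ∈ Ioi x <;> simp [h]
  have hR : ∫⁻ t in Ioi 0, F.measure {a : ℝ | t < a} * ENNReal.ofReal ((Ioi x).indicator q t) =
      ∫⁻ s in Ioi x, ENNReal.ofReal (q s * (1 - F s)) := by
    rw [← lintegral_indicator measurableSet_Ioi, ← lintegral_indicator measurableSet_Ioi]
    refine lintegral_congr fun t => ?_
    by_cases h : t ∈ Ioi x
    · have ht0 : t ∈ Ioi (0 : ℝ) := hx.trans h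
      rw [indicator_of_mem ht0, indicator_of_mem h, indicator_of_mem h,
        ENNReal.ofReal_mul (hq0 t h), mul_comm]
      congr 1
      exact F.measure_Ioi htop t
    · rw [indicator_of_notMem h]
      by_cases h2 : t ∈ Ioi (0 : ℝ) <;> simp [h, h2]
  rw [hL, hR] at hlc
  rw [williamson, integral_eq_lintegral_of_nonneg_ae, integral_eq_lintegral_of_nonneg_ae]
  · exact congrArg ENNReal.toReal hlc
  · refine (ae_restrict_iff' measurableSet_Ioi).2 (Eventually.of_forall fun t ht => ?_)
    exact mul_nonneg (hq0 t ht) (sub_nonneg.2 (F.mono.ge_of_tendsto htop t))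
  · exact (hqm.mul (measurable_const.sub F.mono.measurable)).aestronglyMeasurable
  · refine (ae_restrict_iff' measurableSet_Ioi).2 (Eventually.of_forall fun t ht => ?_)
    exact pow_nonneg (hu t ht).1 _
  · exact (by fun_prop : Measurable fun t : ℝ => (1 - x / t) ^ (n + 2 - 1)).aestronglyMeasurable

end Survival

/-! ### Self-neglecting scales. -/

/-- A positive function that is self-neglecting and negligible with respect to the identity
along `l`. -/
structure IsSelfNeglecting (a : ℝ → ℝ) (l : Filter ℝ) : Prop where
  pos : ∀ x, 0 < a x
  shift : ∀ t, Tendsto (fun x => x + a x * t) l l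
  self : ∀ t, Tendsto (fun x => a (x + a x * t) / a x) l (𝓝 1)
  small : Tendsto (fun x => a x / x) l (𝓝 0)
  arg_pos : ∀ᶠ x in l, 0 < x

theorem IsContSurvival.isSelfNeglecting {g a : ℝ → ℝ} {e : EReal} (hg : IsContSurvival g e)
    (h : GammaVarying g a (upTo e)) (ha : ∀ x, 0 < a x) : IsSelfNeglecting a (upTo e) :=
  ⟨ha, hg.shift h, hg.self_neglecting h ha, hg.aux_div_tendsto_zero h ha, hg.eventually_arg_pos⟩

/-- `Γ`-variation is inherited by functions equivalent to a multiple of `g * r`, for `r` constant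
on the scale `a`. -/
theorem GammaVarying.of_tendsto_div {g g₁ r a : ℝ → ℝ} {l : Filter ℝ} {c : ℝ}
    (h : GammaVarying g a l) (hs : IsSelfNeglecting a l) (hg : ∀ᶠ x in l, 0 < g x)
    (hr0 : ∀ᶠ x in l, 0 < r x) (hr : ∀ t, Tendsto (fun x => r (x + a x * t) / r x) l (𝓝 1))
    (hc : c ≠ 0) (h1 : Tendsto (fun x => g₁ x / (g x * r x)) l (𝓝 c)) :
    GammaVarying g₁ a l := by
  intro t
  have h2 := (((h1.comp (hs.shift t)).div h1 hc).mul (h t)).mul (hr t)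
  rw [div_self hc, one_mul, mul_one] at h2
  refine h2.congr' ?_
  filter_upwards [h1.eventually_ne hc, hg, hr0, (hs.shift t).eventually hg,
    (hs.shift t).eventually hr0] with x hx h3 h4 h5 h6
  have h7 : g₁ x ≠ 0 := fun h0 => hx (by simp [h0])
  simp only [Function.comp, Pi.div_apply]
  field_simp

namespace IsSelfNeglecting

variable {a : ℝ → ℝ} {l : Filter ℝ}

theorem arg_ratio (hs : IsSelfNeglecting a l) (t : ℝ) :
    Tendsto (fun x => (x + a x * t) / x) l (𝓝 1) := by
  have h1 := (hs.small.mul_const t).const_add 1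
  rw [zero_mul, add_zero] at h1
  refine h1.congr' ?_
  filter_upwards [hs.arg_pos] with x hx
  field_simp

end IsSelfNeglecting

theorem integral_pow_mul_exp_neg (n : ℕ) :
    ∫ u in Ioi (0 : ℝ), ((n + 1) * u ^ n) * Real.exp (-u) = (n + 1).factorial := by
  have h1 := Real.Gamma_eq_integral (s := (n : ℝ) + 1) (by positivity)
  rw [Real.Gamma_nat_eq_factorial] at h1
  have h2 : ∀ u : ℝ, (((n : ℝ) + 1) * u ^ n) * Real.exp (-u) =
      ((n : ℝ) + 1) * (Real.exp (-u) * u ^ ((n : ℝ) + 1 - 1)) := by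
    intro u
    rw [add_sub_cancel_right, Real.rpow_natCast]; ring
  simp only [h2]
  rw [integral_const_mul, ← h1, Nat.factorial_succ]
  push_cast; ring

/-! ### From `F` to `ψ`. -/

section Forward

variable {F : StieltjesFunction ℝ}

/-- With `s = x + a x * u` the kernel becomes `(a x / x) ^ (n + 1)` times `(n + 1) * u ^ n * (x / s)
^ (n + 2)`. Here `x / s → 1`, and the limit integral is a Gamma integral. -/
theorem tendsto_williamson_div (n : ℕ) (hbot : Tendsto F atBot (𝓝 0))
    (htop : Tendsto F atTop (𝓝 1)) (h0 : F 0 = 0) (hc : Continuous F) {a : ℝ → ℝ}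
    (ha : ∀ x, 0 < a x) (h : GammaVarying (fun x => 1 - F x) a (upTo (rightEndpoint F))) :
    Tendsto (fun x => williamson (n + 2) F x / ((1 - F x) * (a x / x) ^ (n + 1)))
      (upTo (rightEndpoint F)) (𝓝 (n + 1).factorial) := by
  have hg := F.isContSurvival hbot htop h0 hc
  have hs := hg.isSelfNeglecting h ha
  have h1 := hg.tendsto_integral h ha n (C := n + 1)
    (k := fun x u => ((n + 1) * u ^ n) * (x / (x + a x * u)) ^ (n + 2))
    (k₀ := fun u => (n + 1) * u ^ n) (fun x => by fun_prop) ?_ ?_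
  · rw [integral_pow_mul_exp_neg] at h1
    refine h1.congr' ?_
    filter_upwards [hs.arg_pos, hg.eventually_pos] with x hx hpos
    have hax := ha x
    rw [williamson_eq_integral n hbot htop h0 hx, setIntegral_Ioi_comp_affine _ x hax,
      eq_div_iff (by positivity), mul_comm, ← integral_const_mul, ← integral_const_mul]
    refine setIntegral_congr_fun measurableSet_Ioi fun u hu => ?_
    have hu0 : (0 : ℝ) < u := hu
    have h2 : 0 < x + a x * u := by positivity
    have h3 : 1 - x / (x + a x * u) = a x * u / (x + a x * u) := by
      rw [eq_div_iff h2.ne', sub_mul, div_mul_cancel₀ _ h2.ne']; ring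
    simp only [h3]
    simp only [div_pow, mul_pow, pow_succ]
    field_simp
  · filter_upwards [hs.arg_pos] with x hx u hu
    have hax := ha x
    have h2 : x / (x + a x * u) ≤ 1 := by
      rw [div_le_one (by positivity)]
      have := mul_pos hax hu
      linarith
    rw [abs_of_nonneg (by positivity)]
    exact mul_le_of_le_one_right (by positivity) (pow_le_one₀ (by positivity) h2)
  · intro u _
    have h2 := (((hs.arg_ratio u).inv₀ one_ne_zero).pow (n + 2)).const_mul (((n : ℝ) + 1) * u ^ n)
    simp only [inv_div, inv_one, one_pow, mul_one] at h2
    exact h2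

theorem gammaVarying_williamsonDF {d : ℕ} (hd : 2 ≤ d) (hbot : Tendsto F atBot (𝓝 0))
    (htop : Tendsto F atTop (𝓝 1)) (h0 : F 0 = 0) (hc : Continuous F) {a : ℝ → ℝ}
    (ha : ∀ x, 0 < a x) (h : GammaVarying (fun x => 1 - F x) a (upTo (rightEndpoint F))) :
    GammaVarying (fun x => 1 - williamsonDF d F x) a (upTo (rightEndpoint F)) := by
  obtain ⟨n, rfl⟩ : ∃ n, d = n + 2 := ⟨d - 2, by omega⟩
  have hg := F.isContSurvival hbot htop h0 hc
  have hs := hg.isSelfNeglecting h ha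
  refine h.of_tendsto_div hs hg.eventually_pos (r := fun x => (a x / x) ^ (n + 1)) ?_ ?_
    (by exact_mod_cast (n + 1).factorial_ne_zero)
    ((tendsto_williamson_div n hbot htop h0 hc ha h).congr' ?_)
  · filter_upwards [hs.arg_pos] with x hx
    have := ha x
    positivity
  · intro t
    have h1 := ((hs.self t).mul ((hs.arg_ratio t).inv₀ one_ne_zero)).pow (n + 1)
    rw [inv_one, mul_one, one_pow] at h1
    refine h1.congr fun x => ?_
    rw [← div_pow, inv_div, div_mul_div_comm, div_div_div_eq, mul_comm (a x) (x + a x * t)]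
  · filter_upwards [hs.arg_pos] with x hx
    rw [williamsonDF, if_neg (not_lt.2 hx.le), sub_sub_cancel]

end Forward

/-! ### From `ψ` to `F`. -/

section Backward

variable {a : ℝ → ℝ} {l : Filter ℝ}

/-- The monotone density theorem for `Γ`-variation. -/
theorem IsDecrementDensity.tendsto {g₁ g : ℝ → ℝ} (hd : IsDecrementDensity g₁ g)
    (hs : IsSelfNeglecting a l) (hg : ∀ᶠ x in l, 0 < g x) (h : GammaVarying g a l) :
    Tendsto (fun x => a x * g₁ x / g x) l (𝓝 1) := by
  have hexp : Tendsto (fun t : ℝ => (1 - Real.exp (-t)) / t) (𝓝[≠] 0) (𝓝 1) := by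
    have h1 : HasDerivAt (fun t : ℝ => 1 - Real.exp (-t)) 1 0 := by
      have := ((hasDerivAt_neg (0 : ℝ)).exp).const_sub 1
      simpa using this
    have h2 := hasDerivAt_iff_tendsto_slope.1 h1
    refine h2.congr fun t => ?_
    simp [slope_def_field]
  -- As `g₁` is non-increasing, a forward step `t > 0` bounds `g₁ x` below and a backward step `t <
  -- 0` bounds it above; both bounds tend to `1` as `t → 0`.
  refine tendsto_order.2 ⟨fun b hb => ?_, fun b hb => ?_⟩
  · obtain ⟨t, ht1, ht2⟩ := ((hexp.eventually (lt_mem_nhds hb)).filter_mono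
      (nhdsWithin_mono 0 (fun t ht => ne_of_gt ht : Ioi (0 : ℝ) ⊆ {0}ᶜ)) |>.and
      self_mem_nhdsWithin).exists
    have ht0 : 0 < t := ht2
    rw [lt_div_iff₀ ht0, lt_sub_comm] at ht1
    filter_upwards [(h t).eventually (gt_mem_nhds ht1), hg, hs.arg_pos] with x h1 h2 h3
    have h4 := mul_pos (hs.pos x) ht0
    have h5 := (hd x (x + a x * t) h3 (by linarith)).2
    rw [add_sub_cancel_left] at h5
    rw [div_lt_iff₀ h2] at h1
    rw [lt_div_iff₀ h2]
    refine lt_of_mul_lt_mul_left ?_ ht0.le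
    linarith
  · obtain ⟨t, ht1, ht2⟩ := ((hexp.eventually (gt_mem_nhds hb)).filter_mono
      (nhdsWithin_mono 0 (fun t ht => ne_of_lt ht : Iio (0 : ℝ) ⊆ {0}ᶜ)) |>.and
      self_mem_nhdsWithin).exists
    have ht0 : t < 0 := ht2
    rw [div_lt_iff_of_neg ht0, lt_sub_comm] at ht1
    filter_upwards [(h t).eventually (gt_mem_nhds ht1), hg,
      (hs.shift t).eventually hs.arg_pos] with x h1 h2 h3
    have h4 := mul_neg_of_pos_of_neg (hs.pos x) ht0
    have h5 := (hd (x + a x * t) x h3 (by linarith)).1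
    rw [sub_add_cancel_left] at h5
    rw [div_lt_iff₀ h2] at h1
    rw [div_lt_iff₀ h2]
    refine lt_of_mul_lt_mul_left ?_ (neg_pos.2 ht0).le
    linarith

theorem IsDecrementDensity.gammaVarying {g₁ g : ℝ → ℝ} (hd : IsDecrementDensity g₁ g)
    (hs : IsSelfNeglecting a l) (hg : ∀ᶠ x in l, 0 < g x) (h : GammaVarying g a l) :
    GammaVarying g₁ a l := by
  refine h.of_tendsto_div hs hg (r := fun x => (a x)⁻¹)
    (Eventually.of_forall fun x => inv_pos.2 (hs.pos x)) (fun t => ?_) one_ne_zero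
    ((hd.tendsto hs hg h).congr fun x => ?_)
  · have h1 := (hs.self t).inv₀ one_ne_zero
    rw [inv_one] at h1
    refine h1.congr fun x => ?_
    rw [inv_div, inv_div_inv]
  · have := (hs.pos x).ne'
    rw [← div_eq_mul_inv, div_div_eq_mul_div, mul_comm]

theorem GammaVarying.const_mul_iff {g : ℝ → ℝ} {c : ℝ} (hc : c ≠ 0) :
    GammaVarying (fun x => c * g x) a l ↔ GammaVarying g a l := by
  simp only [GammaVarying, mul_div_mul_left _ _ hc]

variable {μ : Measure ℝ} [IsFiniteMeasure μ] {n : ℕ}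

theorem gammaVarying_weightedTail (hs : IsSelfNeglecting a l)
    (hμ : ∀ᶠ x in l, 0 < μ (Ioi x)) (h : GammaVarying (weightedTail μ n n) a l) {j : ℕ}
    (hj : j ≤ n) : GammaVarying (weightedTail μ n j) a l := by
  induction hj using Nat.decreasingInduction with
  | self => exact h
  | of_succ k hk ih =>
    have hpos : ∀ᶠ x in l, 0 < weightedTail μ n (k + 1) x := by
      filter_upwards [hμ, hs.arg_pos] with x h1 h2 using weightedTail_pos hk h2 h1
    have h1 := (weightedTail_isDecrementDensity hk).gammaVarying hs hpos ih
    exact (GammaVarying.const_mul_iff (by positivity)).1 h1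

/-- Consecutive moments satisfy `M_{k+1} / (x * M_k) ~ (k + 1) * a x / x → 0`, so every index above
`0` is negligible after scaling. -/
theorem tendsto_weightedTail_div (hs : IsSelfNeglecting a l)
    (hμ : ∀ᶠ x in l, 0 < μ (Ioi x)) (h : GammaVarying (weightedTail μ n n) a l) {j : ℕ}
    (hj : j ≤ n) : Tendsto (fun x => weightedTail μ n j x / (x ^ j * weightedTail μ n 0 x)) l
      (𝓝 (if j = 0 then 1 else 0)) := by
  have hpos : ∀ j ≤ n, ∀ᶠ x in l, 0 < weightedTail μ n j x := fun j hj => by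
    filter_upwards [hμ, hs.arg_pos] with x h1 h2 using weightedTail_pos hj h2 h1
  induction j with
  | zero =>
    rw [if_pos rfl]
    refine tendsto_const_nhds.congr' ?_
    filter_upwards [hpos 0 hj] with x hx
    rw [pow_zero, one_mul, div_self hx.ne']
  | succ k ih =>
    have hk : k ≤ n := (Nat.le_succ k).trans hj
    have h1 := (weightedTail_isDecrementDensity hj).tendsto hs (hpos _ hj)
      (gammaVarying_weightedTail hs hμ h hj)
    have h2 := (((h1.inv₀ one_ne_zero).mul hs.small).mul (ih hk)).const_mul ((k : ℝ) + 1)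
    rw [mul_zero, zero_mul, mul_zero] at h2
    rw [if_neg (Nat.succ_ne_zero k)]
    refine h2.congr' ?_
    filter_upwards [hpos _ hj, hpos k hk, hpos 0 (Nat.zero_le n), hs.arg_pos] with x h3 h4 h5 h6
    have h7 := hs.pos x
    rw [inv_div, pow_succ]
    field_simp

theorem tendsto_tail_div (hs : IsSelfNeglecting a l)
    (hμ : ∀ᶠ x in l, 0 < μ (Ioi x)) (h : GammaVarying (weightedTail μ n n) a l) :
    Tendsto (fun x => μ.real (Ioi x) / (weightedTail μ n 0 x * x ^ n)) l (𝓝 1) := by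
  have h1 : Tendsto (fun x => ∑ j ∈ Finset.range (n + 1), (n.choose j : ℝ) *
      (weightedTail μ n j x / (x ^ j * weightedTail μ n 0 x))) l
      (𝓝 (∑ j ∈ Finset.range (n + 1), (n.choose j : ℝ) * (if j = 0 then 1 else 0))) :=
    tendsto_finsetSum _ fun j hj => (tendsto_weightedTail_div hs hμ h
      (Nat.lt_succ_iff.1 (Finset.mem_range.1 hj))).const_mul _
  have h2 : ∑ j ∈ Finset.range (n + 1), (n.choose j : ℝ) * (if j = 0 then 1 else 0) = 1 := by
    simp
  rw [h2] at h1
  refine h1.congr' ?_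
  filter_upwards [hμ, hs.arg_pos] with x h3 h4
  have h5 := weightedTail_pos (Nat.zero_le n) h4 h3
  rw [tail_eq_sum_weightedTail n h4, Finset.sum_div]
  refine Finset.sum_congr rfl fun j hj => ?_
  have h6 : x ^ n = x ^ (n - j) * x ^ j := by
    rw [← pow_add, Nat.sub_add_cancel (Nat.lt_succ_iff.1 (Finset.mem_range.1 hj))]
  rw [h6]
  field_simp

theorem gammaVarying_of_williamsonDF {F : StieltjesFunction ℝ} {d : ℕ} (hd : 2 ≤ d)
    (hbot : Tendsto F atBot (𝓝 0)) (htop : Tendsto F atTop (𝓝 1)) (h0 : F 0 = 0)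
    (hc : Continuous F) (ha : ∀ x, 0 < a x)
    (h : GammaVarying (fun x => 1 - williamsonDF d F x) a (upTo (rightEndpoint F))) :
    GammaVarying (fun x => 1 - F x) a (upTo (rightEndpoint F)) := by
  obtain ⟨n, rfl⟩ : ∃ n, d = n + 1 := ⟨d - 1, by omega⟩
  have : IsProbabilityMeasure F.measure := F.isProbabilityMeasure hbot htop
  have hF := F.isContSurvival hbot htop h0 hc
  have hg := isContSurvival_williamsonDF hd hbot htop h0 hc
  have hs := hg.isSelfNeglecting h ha
  have hμ : ∀ᶠ x in upTo (rightEndpoint F), 0 < F.measure (Ioi x) := by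
    filter_upwards [hF.eventually_pos] with x hx
    rwa [F.measure_Ioi htop, ENNReal.ofReal_pos]
  have heq : ∀ x, 0 < x → 1 - williamsonDF (n + 1) F x = weightedTail F.measure n n x := by
    intro x hx
    rw [williamsonDF, if_neg (not_lt.2 hx.le), sub_sub_cancel, williamson_eq_weightedTail _ hx,
      Nat.add_sub_cancel]
  have hG : GammaVarying (weightedTail F.measure n n) a (upTo (rightEndpoint F)) := by
    intro t
    refine (h t).congr' ?_
    filter_upwards [hs.arg_pos, (hs.shift t).eventually hs.arg_pos] with x h1 h2
    simp only [heq _ h1, heq _ h2]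
  refine (gammaVarying_weightedTail hs hμ hG (Nat.zero_le n)).of_tendsto_div hs
    (r := fun x => x ^ n) ?_ ?_ ?_ one_ne_zero ((tendsto_tail_div hs hμ hG).congr fun x => ?_)
  · filter_upwards [hμ, hs.arg_pos] with x h1 h2 using weightedTail_pos (Nat.zero_le n) h2 h1
  · filter_upwards [hs.arg_pos] with x hx using pow_pos hx n
  · intro t
    simpa [div_pow] using (hs.arg_ratio t).pow n
  · rw [F.measureReal_Ioi htop]

end Backward

/-! ### Auxiliary functions and the conclusion. -/

/-- The mean excess function of one survival function is an auxiliary function of any other one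
that is `Γ`-varying on the same scale. -/
theorem isAuxiliaryFunction_meanExcess {G H a : ℝ → ℝ} {e : EReal}
    (hG : IsContSurvival (fun x => 1 - G x) e) (hH : IsContSurvival (fun x => 1 - H x) e)
    (he : rightEndpoint H = e) (ha : ∀ x, 0 < a x)
    (hGa : GammaVarying (fun x => 1 - G x) a (upTo e))
    (hHa : GammaVarying (fun x => 1 - H x) a (upTo e)) :
    IsAuxiliaryFunction H (meanExcess e G) := by
  have hm := hG.tendsto_meanExcess hGa ha (fun _ => rfl)
  unfold IsAuxiliaryFunction
  rw [he]
  refine ⟨fun x hx => hG.meanExcess_pos hGa ha (fun _ => rfl) hx, ?_,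
    hH.gammaVarying_of_equiv hHa ha hm⟩
  have h1 := hm.mul (hG.aux_div_tendsto_zero hGa ha)
  rw [mul_zero] at h1
  refine h1.congr fun x => ?_
  rw [div_mul_div_cancel₀ (ha x).ne']

theorem mainTheorem2 (d : ℕ) (hd : 2 ≤ d) (F : StieltjesFunction ℝ)
    (hbot : Tendsto F atBot (𝓝 0)) (htop : Tendsto F atTop (𝓝 1)) (h0 : F 0 = 0)
    (hdiff : DifferentiableOn ℝ F (Ioi 0) ∨ DifferentiableOn ℝ (williamsonTopDeriv d F) (Ioi 0)) :
    (DifferentiableOn ℝ F (Ioi 0) ∧ DifferentiableOn ℝ (williamsonTopDeriv d F) (Ioi 0)) ∧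
    (MonotoneNearLeft (deriv F) (rightEndpoint F) →
      (InMDA F gumbel ↔ InMDA (williamsonDF d F) gumbel) ∧
      (InMDA F gumbel →
        IsAuxiliaryFunction F (meanExcess (rightEndpoint F) F) ∧
        IsAuxiliaryFunction (williamsonDF d F) (meanExcess (rightEndpoint F) F) ∧
        IsAuxiliaryFunction F (meanExcess (rightEndpoint F) (williamsonDF d F)) ∧
        IsAuxiliaryFunction (williamsonDF d F)
          (meanExcess (rightEndpoint F) (williamsonDF d F)))) := by
  have : IsProbabilityMeasure F.measure := F.isProbabilityMeasure hbot htop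
  have hiff : DifferentiableOn ℝ F (Ioi 0) ↔
      DifferentiableOn ℝ (williamsonTopDeriv d F) (Ioi 0) := by
    obtain ⟨n, rfl⟩ : ∃ n, d = n + 1 := ⟨d - 1, by omega⟩
    exact differentiableOn_iff_williamsonTopDeriv (by omega)
  have hFd : DifferentiableOn ℝ F (Ioi 0) := hdiff.elim id hiff.2
  have hc := F.continuous_of_differentiableOn hbot h0 hFd
  have hF := F.isContSurvival hbot htop h0 hc
  have hW := isContSurvival_williamsonDF hd hbot htop h0 hc
  have hWe := rightEndpoint_williamsonDF hd hbot htop h0 hc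
  refine ⟨⟨hFd, hiff.1 hFd⟩, fun _ => ⟨⟨fun h => ?_, fun h => ?_⟩, fun h => ?_⟩⟩
  · obtain ⟨a, ha, hga⟩ := hF.gammaVarying_of_inMDA (fun _ => rfl) h
    exact hW.inMDA_of_gammaVarying (fun _ => rfl) ha
      (gammaVarying_williamsonDF hd hbot htop h0 hc ha hga)
  · obtain ⟨a, ha, hga⟩ := hW.gammaVarying_of_inMDA (fun _ => rfl) h
    exact hF.inMDA_of_gammaVarying (fun _ => rfl) ha
      (gammaVarying_of_williamsonDF hd hbot htop h0 hc ha hga)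
  · obtain ⟨a, ha, hga⟩ := hF.gammaVarying_of_inMDA (fun _ => rfl) h
    have hwa := gammaVarying_williamsonDF hd hbot htop h0 hc ha hga
    exact ⟨isAuxiliaryFunction_meanExcess hF hF rfl ha hga hga,
      isAuxiliaryFunction_meanExcess hF hW hWe ha hga hwa,
      isAuxiliaryFunction_meanExcess hW hF rfl ha hwa hga,
      isAuxiliaryFunction_meanExcess hW hW hWe ha hwa hwa⟩
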